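/- Let $1\le k\le n$ be integers, let $f:\mathbb R\to(0,+\infty)$ be continuous and non-decreasing, and let $p>1$, $\beta<p-1$ and $-1<\alpha<\frac kn-1$. For $\lambda\in\mathbb R^n$ put $\Pi_k(\lambda)=\prod_{i_1<\cdots<i_k}(\lambda_{i_1}+\cdots+\lambda_{i_k})$ and $\mathcal P_k=\{\lambda\in\mathbb R^n:\lambda_{i_1}+\cdots+\lambda_{i_k}>0\text{ for all }i_1<\cdots<i_k\}$; for a matrix $A$ with real eigenvalues $\lambda(A)$ write $\Pi_k[A]=\Pi_k(\lambda(A))$. Consider the equation $$\Pi_k^{1/\binom nk}\big[D(|Du|^{p-2}Du)\big]=|x|^\alpha|Du|^\beta f(u)\quad\text{in }\mathbb R^n.\qquad(\ast)$$ An entire nontrivial admissible subsolution of $(\ast)$ is a non-constant function $u\in C^1(\mathbb R^n)\cap C^2(\mathbb R^n\setminus\{0\})$ such that at every $x\ne0$ the vector field $|Du|^{p-2}Du$ (taken to be $0$ where $Du=0$) is differentiable, $\lambda(D(|Du|^{p-2}Du))\in\mathcal P_k$, and $\Pi_k^{1/\binom nk}[D(|Du|^{p-2}Du)]\ge|x|^\alpha|Du|^\beta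 f(u)$. (Here $|Du|^\beta=+\infty$ if $\beta<0$ and $Du=0$, and $|Du|^0=1$; the origin is excluded because $|x|^\alpha$ is singular there.) (a) Suppose that for some $\epsilon\in\left(0,\frac{n(\alpha+1)}k\right)$, with $\kappa=\dfrac{1-\epsilon}{\frac{n(\alpha+1)}k-\epsilon}$, $$\int^{+\infty}\left(\int_0^t f^{\frac{\kappa n}k}(s)\,ds\right)^{-\frac1{\frac{\kappa n(p-\beta-1)}k+1}}dt=+\infty ,$$ the lower limit being any positive number. Then $(\ast)$ has an entire nontrivial admissible subsolution $u$, which moreover satisfies: (i) if $p\le\alpha+\beta+2$, then $u\in C^2(\mathbb R^n)$; (ii) if $p>\alpha+\beta+2$ and $(p-1)\alpha+\beta\ge0$, then $u\in W^{2,\delta}_{\rm loc}(\mathbb R^n)$ for every $\delta\in\left(1,\frac{p-\beta-1}{p-\alpha-\beta-2}\right)$. (b) Suppose that $(\ast)$ has an entire nontrivial admissible subsolution $u$ such that either $p\le\alpha+\beta+2$ and $u\in C^2(\mathbb R^n)$, or $p>\alpha+\beta+2$, $(p-1)\alpha+\beta\ge0$ and $u\in W^{2,\delta}_{\rm loc}(\mathbb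 R^n)$ for some $\delta\in\left(1,\frac{p-\beta-1}{p-\alpha-\beta-2}\right)$. Then $$\int^{+\infty}\left(\int_0^t f^{\frac nk}(s)\,ds\right)^{-\frac1{\frac{n(p-\beta-1)}k+1}}dt=+\infty .$$ -/

import Mathlib

open MeasureTheory Set
open scoped ContDiff Gradient

noncomputable section

namespace PiHessian

/-- The Euclidean space `ℝⁿ`. -/
abbrev Rn (n : ℕ) : Type := EuclideanSpace ℝ (Fin n)

/-- The vector field `|Du|^{p-2} Du`; at a zero of `Du` its value is `0`. -/
def pGradField {n : ℕ} (p : ℝ) (u : Rn n → ℝ) (x : Rn n) : Rn n :=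
  ‖∇ u x‖ ^ (p - 2) • ∇ u x

/-- `lam` lists the eigenvalues, with algebraic multiplicity, of the endomorphism `A` of `ℝⁿ`. -/
def IsEigenvalueTuple {n : ℕ} (A : Rn n →L[ℝ] Rn n) (lam : Fin n → ℝ) : Prop :=
  LinearMap.charpoly (A : Rn n →ₗ[ℝ] Rn n) = ∏ i, (Polynomial.X - Polynomial.C (lam i))

/-- The cone `𝒫_k`: all sums of `k` entries at distinct positions are positive. -/
def coneP (n k : ℕ) : Set (Fin n → ℝ) :=
  {lam | ∀ s ∈ Finset.powersetCard k (Finset.univ : Finset (Fin n)), 0 < ∑ i ∈ s, lam i}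

/-- `Π_k(λ)`, the product of all sums of `k` entries at distinct positions. -/
def PiK (n k : ℕ) (lam : Fin n → ℝ) : ℝ :=
  ∏ s ∈ Finset.powersetCard k (Finset.univ : Finset (Fin n)), ∑ i ∈ s, lam i

/-- At the point `x` the matrix `D(|Du|^{p-2}Du)` exists, its eigenvalues lie in `𝒫_k`
(admissibility), and `Π_k^{1/C(n,k)}[D(|Du|^{p-2}Du)] ≥ |x|^α |Du|^β f(u)`.
For `β < 0` the right side is infinite where `Du = 0`, so the inequality requires `Du ≠ 0`. -/
def AdmissibleSubsolutionAt (n k : ℕ) (p α β : ℝ) (f : ℝ → ℝ) (u : Rn n → ℝ) (x : Rn n) : Prop :=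
  DifferentiableAt ℝ (pGradField p u) x ∧
  (β < 0 → ∇ u x ≠ 0) ∧
  ∃ lam : Fin n → ℝ,
    IsEigenvalueTuple (fderiv ℝ (pGradField p u) x) lam ∧
    lam ∈ coneP n k ∧
    ‖x‖ ^ α * ‖∇ u x‖ ^ β * f (u x) ≤ PiK n k lam ^ (1 / (n.choose k : ℝ))

/-- Entire nontrivial admissible subsolution of
`Π_k^{1/C(n,k)}[D(|Du|^{p-2}Du)] = |x|^α |Du|^β f(u)`, for `α < 0`: `u` is `C¹` on `ℝⁿ`, `C²`
outside the origin and nonconstant, and is an admissible subsolution at every `x ≠ 0`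
(for `α < 0` the weight `|x|^α` has no value at the origin). -/
structure IsEntireSubsolution (n k : ℕ) (p α β : ℝ) (f : ℝ → ℝ) (u : Rn n → ℝ) : Prop where
  contDiff_one : ContDiff ℝ 1 u
  contDiffOn_two : ContDiffOn ℝ 2 u {0}ᶜ
  nontrivial : ∃ x y, u x ≠ u y
  subsolution : ∀ x, x ≠ 0 → AdmissibleSubsolutionAt n k p α β f u x

/-- `h ∈ L^δ_loc(ℝⁿ)`. -/
def LpLoc {n : ℕ} (δ : ℝ) (h : Rn n → ℝ) : Prop :=
  ∀ K : Set (Rn n), IsCompact K → MemLp h (ENNReal.ofReal δ) (volume.restrict K)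

/-- `h` is the weak `i`-th partial derivative of `w` on `ℝⁿ` (both locally integrable). -/
def IsWeakPartial {n : ℕ} (i : Fin n) (w h : Rn n → ℝ) : Prop :=
  LocallyIntegrable w volume ∧ LocallyIntegrable h volume ∧
  ∀ φ : Rn n → ℝ, ContDiff ℝ ∞ φ → HasCompactSupport φ →
    ∫ x, w x * fderiv ℝ φ x (EuclideanSpace.single i 1) = - ∫ x, h x * φ x

/-- `u ∈ W^{2,δ}_loc(ℝⁿ)`. -/
def SobolevW2Loc {n : ℕ} (δ : ℝ) (u : Rn n → ℝ) : Prop :=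
  LpLoc δ u ∧
  ∃ (g : Fin n → Rn n → ℝ) (h : Fin n → Fin n → Rn n → ℝ),
    (∀ i, LpLoc δ (g i) ∧ IsWeakPartial i u (g i)) ∧
    (∀ i j, LpLoc δ (h i j) ∧ IsWeakPartial j (g i) (h i j))

/-- The Keller–Osserman condition `∫^{+∞} (∫_0^t g(s) ds)^{-1/(θ+1)} dt = +∞`, the lower limit
being any positive number. -/
def KellerOsserman (g : ℝ → ℝ) (θ : ℝ) : Prop :=
  ∀ t₀ : ℝ, 0 < t₀ →
    ∫⁻ t in Ioi t₀, ENNReal.ofReal ((∫ s in (0 : ℝ)..t, g s) ^ (-(1 / (θ + 1)))) = ⊤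

end PiHessian

end

namespace PiHessian

open Filter Topology
open scoped RealInnerProductSpace

/-! Put F = f^(n/k), q = n(p-β-1)/k and a = n(α+1)/k; the hypotheses give q > 0 and 0 < a < 1. For a
radial u = φ(|x|) with slope w = φ' > 0, the matrix D(|Du|^{p-2}Du) has one radial eigenvalue and
n-1 equal tangential ones. After raising to the power n/k, the subsolution inequality becomes
r^(a-1) F(φ) ≤ k^((n-k)/k) ((p-1)/q · (w^q)' + (k-1) w^q / r), see `radial_inequality_iff`. Both
halves thus reduce to the equation (φ'^q)' = lam · F(φ). Its first integral φ' = Φ(φ) is `profile`,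
and the time needed to reach the value s is ∫ 1/Φ up to s, which stays bounded exactly when the
Keller–Osserman condition for (F, q) fails.

Part (a). Since a < 1, the exponent κ exceeds 1, and Jensen's inequality turns the condition for
(F^κ, κq) into the one for (F, q) (`KellerOsserman.of_rpow`). The first integral then has a global
solution Y, and u = Y(|x|^m) with m = 1 + a/q is a subsolution (`exists_radial_profile`,
`isEntireSubsolution_radial`). The power m absorbs the weight r^(a-1) and governs regularity at the
origin: u is C² when m ≥ 2, and D²u = O(|x|^(m-2)) otherwise.

Part (b). If the condition for (F, q) fails, solutions of (φ'^q)' = lam · F(φ) blow up within a time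
of order lam^(-1/(q+1)). On the scale ρ the weight allows lam comparable to ρ^(a-1), so this time is
at most ρ once ρ is large. Let T be the inverse of such a solution. The maximum of u over spheres is
strictly increasing, which provides a radius from which u outgrows φ for a moment; since T is
bounded, T(u) - |x| then has an interior maximum in an annulus. There the Hessian of u lies below
that of a radial model, and monotonicity of Π_k on the cone bounds the weight by half of its true
size, a contradiction (`IsEntireSubsolution.weight_le_of_isLocalMax`,
`IsEntireSubsolution.kellerOsserman`). -/

/-! ### Spike tuples, the cone 𝒫_k and the product Π_k -/

/-- The tuple with entry `d₁` at `j` and entries `d₂` elsewhere. -/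
def spike {n : ℕ} (j : Fin n) (d₁ d₂ : ℝ) : Fin n → ℝ :=
  fun i => if i = j then d₁ else d₂

theorem sum_spike_of_mem {n : ℕ} {j : Fin n} (d₁ d₂ : ℝ) {s : Finset (Fin n)} (hj : j ∈ s) :
    ∑ i ∈ s, spike j d₁ d₂ i = d₁ + ((s.card : ℝ) - 1) * d₂ := by
  rw [← Finset.add_sum_erase s _ hj]
  have h : ∑ i ∈ s.erase j, spike j d₁ d₂ i = ∑ i ∈ s.erase j, d₂ :=
    Finset.sum_congr rfl fun i hi => by simp [spike, Finset.ne_of_mem_erase hi]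
  rw [h, Finset.sum_const, Finset.card_erase_of_mem hj, nsmul_eq_mul,
    Nat.cast_sub (Finset.one_le_card.2 ⟨j, hj⟩)]
  simp [spike]

theorem sum_spike_of_notMem {n : ℕ} {j : Fin n} (d₁ d₂ : ℝ) {s : Finset (Fin n)} (hj : j ∉ s) :
    ∑ i ∈ s, spike j d₁ d₂ i = s.card * d₂ := by
  have h : ∑ i ∈ s, spike j d₁ d₂ i = ∑ i ∈ s, d₂ :=
    Finset.sum_congr rfl fun i hi => by
      have hij : i ≠ j := fun h => hj (h ▸ hi)
      simp [spike, hij]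
  rw [h, Finset.sum_const, nsmul_eq_mul]

theorem card_powersetCard_filter_mem {n k : ℕ} (hk : 1 ≤ k) (j : Fin n) :
    ((Finset.powersetCard k (Finset.univ : Finset (Fin n))).filter (fun s => j ∈ s)).card
      = (n - 1).choose (k - 1) := by
  obtain ⟨k, rfl⟩ : ∃ l, k = l + 1 := ⟨k - 1, by omega⟩
  rw [← Finset.insert_erase (Finset.mem_univ j), Finset.powersetCard_succ_insert (by simp),
    Finset.filter_union, Finset.filter_false_of_mem, Finset.empty_union, Finset.filter_true_of_mem,
    Finset.card_image_of_injOn, Finset.card_powersetCard, Finset.card_erase_of_mem (by simp)]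
  · simp
  · intro s hs t ht hst
    have hs' : j ∉ s := fun h => by
      simpa using (Finset.mem_powersetCard.1 (Finset.mem_coe.1 hs)).1 h
    have ht' : j ∉ t := fun h => by
      simpa using (Finset.mem_powersetCard.1 (Finset.mem_coe.1 ht)).1 h
    rw [← Finset.erase_insert hs', ← Finset.erase_insert ht', hst]
  · intro s hs
    obtain ⟨t, -, rfl⟩ := Finset.mem_image.1 hs
    simp
  · intro s hs h
    simpa using (Finset.mem_powersetCard.1 hs).1 h

theorem card_powersetCard_filter_notMem {n k : ℕ} (j : Fin n) :
    ((Finset.powersetCard k (Finset.univ : Finset (Fin n))).filter (fun s => j ∉ s)).card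
      = (n - 1).choose k := by
  have : (Finset.powersetCard k (Finset.univ : Finset (Fin n))).filter (fun s => j ∉ s)
      = Finset.powersetCard k (Finset.univ.erase j) := by
    ext s
    simp only [Finset.mem_filter, Finset.mem_powersetCard, Finset.subset_univ, true_and,
      Finset.subset_erase]
    tauto
  rw [this, Finset.card_powersetCard, Finset.card_erase_of_mem (by simp)]
  simp

theorem PiK_spike {n k : ℕ} (hk : 1 ≤ k) (j : Fin n) (d₁ d₂ : ℝ) :
    PiK n k (spike j d₁ d₂) =
      (d₁ + ((k : ℝ) - 1) * d₂) ^ (n - 1).choose (k - 1) * (k * d₂) ^ (n - 1).choose k := by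
  unfold PiK
  rw [← Finset.prod_filter_mul_prod_filter_not _ (fun s => j ∈ s),
    ← card_powersetCard_filter_mem hk j, ← card_powersetCard_filter_notMem (k := k) j]
  congr 1
  · refine Finset.prod_eq_pow_card fun s hs => ?_
    simp only [Finset.mem_filter, Finset.mem_powersetCard] at hs
    rw [sum_spike_of_mem _ _ hs.2, hs.1.2]
  · refine Finset.prod_eq_pow_card fun s hs => ?_
    simp only [Finset.mem_filter, Finset.mem_powersetCard] at hs
    rw [sum_spike_of_notMem _ _ hs.2, hs.1.2]

/-- These ratios are the exponents left in Π_k of a spike after taking the root of order C(n,k). -/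
theorem choose_pred_div_choose {n k : ℕ} (hk : 1 ≤ k) (hkn : k ≤ n) :
    ((n - 1).choose (k - 1) : ℝ) / n.choose k = k / n ∧
      ((n - 1).choose k : ℝ) / n.choose k = (n - k) / n := by
  obtain ⟨k, rfl⟩ : ∃ l, k = l + 1 := ⟨k - 1, by omega⟩
  obtain ⟨n, rfl⟩ : ∃ l, n = l + 1 := ⟨n - 1, by omega⟩
  have h1 : ((n + 1 : ℕ) : ℝ) * n.choose k = (n + 1).choose (k + 1) * (k + 1 : ℕ) := by
    exact_mod_cast Nat.add_one_mul_choose_eq n k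
  have h2 : ((n + 1).choose (k + 1) : ℝ) = n.choose k + n.choose (k + 1) := by
    exact_mod_cast Nat.choose_succ_succ n k
  have hpos : (0 : ℝ) < (n + 1).choose (k + 1) := by exact_mod_cast Nat.choose_pos hkn
  have hn : (0 : ℝ) < ((n + 1 : ℕ) : ℝ) := by positivity
  simp only [Nat.add_sub_cancel]
  constructor <;> rw [div_eq_div_iff hpos.ne' hn.ne'] <;> push_cast at * <;>
    first | linarith | (rw [h2] at h1 ⊢; linarith)

theorem PiK_spike_rpow {n k : ℕ} (hk : 1 ≤ k) (hkn : k ≤ n) (j : Fin n) {d₁ d₂ : ℝ}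
    (h₁ : 0 < d₁ + ((k : ℝ) - 1) * d₂) (h₂ : 0 < d₂) :
    PiK n k (spike j d₁ d₂) ^ (1 / (n.choose k : ℝ)) =
      (d₁ + ((k : ℝ) - 1) * d₂) ^ ((k : ℝ) / n) * (k * d₂) ^ (((n : ℝ) - k) / n) := by
  have hk' : (0 : ℝ) < k := by exact_mod_cast hk
  rw [PiK_spike hk, Real.mul_rpow (by positivity) (by positivity), ← Real.rpow_natCast,
    ← Real.rpow_natCast, ← Real.rpow_mul h₁.le, ← Real.rpow_mul (by positivity), mul_one_div,
    mul_one_div, (choose_pred_div_choose hk hkn).1, (choose_pred_div_choose hk hkn).2]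

theorem spike_mem_coneP {n k : ℕ} (hk : 1 ≤ k) (j : Fin n) {d₁ d₂ : ℝ}
    (h₁ : 0 < d₁ + ((k : ℝ) - 1) * d₂) (h₂ : 0 < d₂) : spike j d₁ d₂ ∈ coneP n k := by
  intro s hs
  have hk' : (0 : ℝ) < k := by exact_mod_cast hk
  have hc := (Finset.mem_powersetCard.1 hs).2
  by_cases hj : j ∈ s
  · rw [sum_spike_of_mem _ _ hj, hc]; exact h₁
  · rw [sum_spike_of_notMem _ _ hj, hc]; positivity

theorem PiK_mono {n k : ℕ} {lam μ : Fin n → ℝ} (h : lam ∈ coneP n k) (hle : ∀ i, lam i ≤ μ i) :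
    PiK n k lam ≤ PiK n k μ :=
  Finset.prod_le_prod (fun s hs => (h s hs).le) fun _ _ => Finset.sum_le_sum fun i _ => hle i

theorem PiK_pos {n k : ℕ} {lam : Fin n → ℝ} (h : lam ∈ coneP n k) : 0 < PiK n k lam :=
  Finset.prod_pos fun s hs => h s hs

theorem coneP_mono {n k : ℕ} {lam μ : Fin n → ℝ} (h : lam ∈ coneP n k)
    (hle : ∀ i, lam i ≤ μ i) : μ ∈ coneP n k :=
  fun s hs => (h s hs).trans_le (Finset.sum_le_sum fun i _ => hle i)

theorem exists_pos_of_mem_coneP {n k : ℕ} (hkn : k ≤ n) {lam : Fin n → ℝ}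
    (h : lam ∈ coneP n k) : ∃ i, 0 < lam i := by
  obtain ⟨s, hs⟩ := Finset.exists_subset_card_eq (s := (Finset.univ : Finset (Fin n))) (n := k)
    (by simpa using hkn)
  have := h s (Finset.mem_powersetCard.2 hs)
  obtain ⟨i, -, hi⟩ := Finset.exists_lt_of_sum_lt (s := s) (f := fun _ => (0 : ℝ)) (g := lam)
    (by simpa using this)
  exact ⟨i, hi⟩

theorem exists_powersetCard_mem {n k : ℕ} (hk : 1 ≤ k) (hkn : k ≤ n) (j : Fin n) :
    ∃ s ∈ Finset.powersetCard k (Finset.univ : Finset (Fin n)), j ∈ s := by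
  obtain ⟨s, h1, -, h2⟩ := Finset.exists_subsuperset_card_eq (s := {j})
    (t := (Finset.univ : Finset (Fin n))) (n := k) (by simp) (by simpa using hk) (by simpa using hkn)
  exact ⟨s, by simpa using h2, by simpa using h1⟩

theorem spike_pos_of_mem_coneP {n k : ℕ} (hk : 1 ≤ k) (hkn : k ≤ n) {j : Fin n} {d₁ d₂ : ℝ}
    (h : spike j d₁ d₂ ∈ coneP n k) : 0 < d₁ + ((k : ℝ) - 1) * d₂ := by
  obtain ⟨s, hs, hj⟩ := exists_powersetCard_mem hk hkn j
  have := h s hs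
  rwa [sum_spike_of_mem _ _ hj, (Finset.mem_powersetCard.1 hs).2] at this

/-- A spike with nonpositive top entry and negative remaining entries is not admissible. -/
theorem spike_notMem_coneP {n k : ℕ} (hk : 1 ≤ k) (hkn : k ≤ n) {j : Fin n} {d₁ d₂ : ℝ}
    (h₁ : d₁ ≤ 0) (h₂ : d₂ ≤ 0) : spike j d₁ d₂ ∉ coneP n k := by
  intro h
  have := spike_pos_of_mem_coneP hk hkn h
  have hk' : (1 : ℝ) ≤ k := by exact_mod_cast hk
  nlinarith

/-! ### Eigenvalue comparison with a spike -/

/-- Equal multiplicities give bijections between the fibres over each value, and these glue to a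
permutation. It identifies two eigenvalue lists of one characteristic polynomial up to order. -/
theorem exists_perm_of_map_univ_eq {ι γ : Type*} [Fintype ι] {f g : ι → γ}
    (h : Multiset.map f Finset.univ.val = Multiset.map g Finset.univ.val) :
    ∃ σ : Equiv.Perm ι, f ∘ σ = g := by
  classical
  have hcard : ∀ c, Nonempty ({a // g a = c} ≃ {a // f a = c}) := fun c => by
    rw [← Fintype.card_eq, Fintype.card_subtype, Fintype.card_subtype]
    have := congrArg (Multiset.count c) h
    rw [Multiset.count_map, Multiset.count_map] at this
    simpa [Finset.card, Finset.filter_val, eq_comm] using this.symm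
  exact ⟨Equiv.ofFiberEquiv fun c => (hcard c).some,
    funext fun a => Equiv.ofFiberEquiv_map (fun c => (hcard c).some) a⟩

/-- A symmetric operator lying below `d₁ ν ⊗ ν + d₂ (I - ν ⊗ ν)` has eigenvalues below a spike. -/
theorem exists_eigenvalues_le_spike {n : ℕ} {N : Rn n →ₗ[ℝ] Rn n} (hN : N.IsSymmetric)
    {ν : Rn n} (hν : ‖ν‖ = 1) {d₁ d₂ : ℝ}
    (hle : ∀ h, ⟪N h, h⟫ ≤ d₁ * ⟪ν, h⟫ ^ 2 + d₂ * (‖h‖ ^ 2 - ⟪ν, h⟫ ^ 2)) {lam : Fin n → ℝ}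
    (hlam : N.charpoly = ∏ i, (Polynomial.X - Polynomial.C (lam i))) :
    ∃ j, ∀ i, lam i ≤ spike j d₁ d₂ i := by
  have hn : Module.finrank ℝ (Rn n) = n := by simp
  set b := hN.eigenvectorBasis hn
  set ev := hN.eigenvalues hn
  obtain ⟨σ, hσ⟩ : ∃ σ : Equiv.Perm (Fin n), lam ∘ σ = ev := by
    have h1 : N.charpoly = ∏ i, (Polynomial.X - Polynomial.C (ev i)) := by
      simpa using hN.charpoly_eq hn
    have h2 : Multiset.map lam Finset.univ.val = Multiset.map ev Finset.univ.val := by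
      have e1 := Polynomial.roots_multiset_prod_X_sub_C (Multiset.map lam Finset.univ.val)
      have e2 := Polynomial.roots_multiset_prod_X_sub_C (Multiset.map ev Finset.univ.val)
      rw [← e1, ← e2, Multiset.map_map, Multiset.map_map]
      change (∏ i, (Polynomial.X - Polynomial.C (lam i))).roots
        = (∏ i, (Polynomial.X - Polynomial.C (ev i))).roots
      rw [← hlam, h1]
    exact exists_perm_of_map_univ_eq h2
  suffices ∃ j, ∀ i, ev i ≤ spike j d₁ d₂ i by
    obtain ⟨j, hj⟩ := this
    refine ⟨σ j, fun i => ?_⟩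
    have := hj (σ.symm i)
    rw [← hσ] at this
    simpa [spike, Equiv.symm_apply_eq] using this
  have hNb : ∀ i, N (b i) = ev i • b i := fun i =>
    hN.apply_eigenvectorBasis hn i
  have hbn : ∀ i, ‖b i‖ = 1 := fun i => b.orthonormal.1 i
  have hb : ∀ i, ev i ≤ d₁ * ⟪ν, b i⟫ ^ 2 + d₂ * (1 - ⟪ν, b i⟫ ^ 2) := fun i => by
    have := hle (b i)
    rw [hNb, inner_smul_left, real_inner_self_eq_norm_sq, hbn] at this
    simpa using this
  have ht : ∀ i, ⟪ν, b i⟫ ^ 2 ≤ 1 := fun i => by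
    have := abs_real_inner_le_norm ν (b i)
    rw [hν, hbn] at this
    rw [sq_le_one_iff_abs_le_one]; linarith
  have hsum : ∑ i, ⟪ν, b i⟫ ^ 2 = 1 := by
    have := b.sum_sq_norm_inner_left ν
    simpa [hν] using this
  -- The number ⟪N ν, ν⟫ ≤ d₁ is a mean of the eigenvalues with weights ⟪ν, b i⟫², so they cannot
  -- all exceed d₁.
  have hex : ∃ j, ev j ≤ d₁ := by
    by_contra! hcon
    have h1 : ⟪N ν, ν⟫ = ∑ i, ev i * ⟪ν, b i⟫ ^ 2 := by
      rw [← b.sum_inner_mul_inner (N ν) ν]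
      refine Finset.sum_congr rfl fun i _ => ?_
      rw [hN, hNb, inner_smul_right, real_inner_comm ν (b i)]; ring
    have h2 := hle ν
    rw [h1, real_inner_self_eq_norm_sq, hν] at h2
    obtain ⟨i, -, hi⟩ := Finset.exists_lt_of_sum_lt (s := Finset.univ)
      (f := fun _ : Fin n => (0 : ℝ)) (g := fun i => ⟪ν, b i⟫ ^ 2) (by simp [hsum])
    have h3 : ∑ i, d₁ * ⟪ν, b i⟫ ^ 2 < ∑ i, ev i * ⟪ν, b i⟫ ^ 2 :=
      Finset.sum_lt_sum (fun i _ => by gcongr; exact (hcon i).le)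
        ⟨i, by simp, by gcongr; exact hcon i⟩
    rw [← Finset.mul_sum, hsum] at h3
    linarith
  obtain ⟨j₀, hj₀⟩ := hex
  rcases le_total d₁ d₂ with hd | hd
  · refine ⟨j₀, fun i => ?_⟩
    by_cases hi : i = j₀
    · simpa [spike, hi] using hj₀
    · simp only [spike, hi, if_false]
      nlinarith [hb i, sq_nonneg (⟪ν, b i⟫)]
  · have hev : ∀ i, ev i ≤ d₁ := fun i => by nlinarith [hb i, ht i]
    by_cases hall : ∀ i, ev i ≤ d₂
    · refine ⟨j₀, fun i => ?_⟩
      by_cases hi : i = j₀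
      · simpa [spike, hi] using hj₀
      · simpa [spike, hi] using hall i
    push Not at hall
    obtain ⟨j, hj⟩ := hall
    refine ⟨j, fun i => ?_⟩
    by_cases hi : i = j
    · simpa [spike, hi] using hev j
    simp only [spike, hi, if_false]
    by_contra! hlt
    -- Two eigenvalues above d₂ are impossible: the plane of their eigenvectors contains a nonzero
    -- vector orthogonal to ν, on which the quadratic form is at most d₂ times the squared norm.
    have key : ∀ x y : ℝ, x * ⟪ν, b i⟫ + y * ⟪ν, b j⟫ = 0 →
        x ^ 2 * ev i + y ^ 2 * ev j ≤ d₂ * (x ^ 2 + y ^ 2) := by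
      intro x y hxy
      have hij : ⟪b i, b j⟫ = 0 := b.orthonormal.2 hi
      have hji : ⟪b j, b i⟫ = 0 := b.orthonormal.2 (Ne.symm hi)
      have h1 := hle (x • b i + y • b j)
      have h2 : ⟪ν, x • b i + y • b j⟫ = 0 := by
        rw [inner_add_right, inner_smul_right, inner_smul_right]; exact hxy
      have h3 : ‖x • b i + y • b j‖ ^ 2 = x ^ 2 + y ^ 2 := by
        rw [← real_inner_self_eq_norm_sq, inner_add_left, inner_add_right, inner_add_right]
        simp only [real_inner_smul_left, real_inner_smul_right,
          hij, hji]
        simp only [real_inner_self_eq_norm_sq, hbn]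
        ring
      have h4 : ⟪N (x • b i + y • b j), x • b i + y • b j⟫ = x ^ 2 * ev i + y ^ 2 * ev j := by
        simp only [map_add, map_smul, hNb, inner_add_left, inner_add_right, real_inner_smul_left,
          real_inner_smul_right, hij, hji]
        simp only [real_inner_self_eq_norm_sq, hbn]
        ring
      rw [h2, h3, h4] at h1
      simpa using h1
    by_cases h0 : ⟪ν, b j⟫ = 0 ∧ ⟪ν, b i⟫ = 0
    · have := key 1 0 (by simp [h0])
      norm_num at this
      linarith
    · have h1 := key ⟪ν, b j⟫ (-⟪ν, b i⟫) (by ring)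
      rcases not_and_or.1 h0 with h | h
      · have := sq_pos_of_ne_zero h
        nlinarith [sq_nonneg ⟪ν, b i⟫]
      · have := sq_pos_of_ne_zero h
        nlinarith [sq_nonneg ⟪ν, b j⟫]

/-! ### Axial operators and the Jacobian of |Du|^{p-2}Du -/

/-- The operator `s (a ν ⊗ ν + (I - ν ⊗ ν))`. -/
noncomputable def axial {n : ℕ} (ν : Rn n) (a s : ℝ) : Rn n →L[ℝ] Rn n :=
  s • (ContinuousLinearMap.id ℝ (Rn n) + (a - 1) • (innerSL ℝ ν).smulRight ν)

theorem axial_apply {n : ℕ} (ν : Rn n) (a s : ℝ) (h : Rn n) :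
    axial ν a s h = s • (h + ((a - 1) * ⟪ν, h⟫) • ν) := by
  simp [axial, smul_smul, mul_assoc]

theorem axial_comp_axial {n : ℕ} {ν : Rn n} (hν : ‖ν‖ = 1) (a s a' s' : ℝ) (h : Rn n) :
    axial ν a s (axial ν a' s' h) = axial ν (a * a') (s * s') h := by
  simp only [axial_apply, inner_add_right, inner_smul_right, real_inner_self_eq_norm_sq, hν]
  module

/-- Used to replace the non-symmetric product Q²H by the symmetric QHQ without changing the
eigenvalues. -/
theorem charpoly_comp_comm {n : ℕ} (A B : Rn n →ₗ[ℝ] Rn n) :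
    (A ∘ₗ B).charpoly = (B ∘ₗ A).charpoly := by
  let b := (EuclideanSpace.basisFun (Fin n) ℝ).toBasis
  rw [← LinearMap.charpoly_toMatrix _ b, ← LinearMap.charpoly_toMatrix _ b,
    LinearMap.toMatrix_comp b b b, LinearMap.toMatrix_comp b b b, Matrix.charpoly_mul_comm]

/-- An orthonormal basis with ν in position j diagonalises the operator. -/
theorem isEigenvalueTuple_axial {n : ℕ} {ν : Rn n} (hν : ‖ν‖ = 1) (j : Fin n) (a s : ℝ) :
    IsEigenvalueTuple (axial ν a s) (spike j (s * a) s) := by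
  have hv : Orthonormal ℝ (({j} : Set (Fin n)).domRestrict (fun _ => ν)) := by
    constructor
    · intro i; simpa using hν
    · intro i i' h
      exact absurd (Subsingleton.elim i i') h
  obtain ⟨b, hb⟩ := hv.exists_orthonormalBasis_extension_of_card_eq (by simp)
  have hbj : b j = ν := hb j (by simp)
  unfold IsEigenvalueTuple
  have : LinearMap.toMatrix b.toBasis b.toBasis (axial ν a s : Rn n →ₗ[ℝ] Rn n)
      = Matrix.diagonal (spike j (s * a) s) := by
    ext i i'
    rw [LinearMap.toMatrix_apply]
    simp only [OrthonormalBasis.coe_toBasis, OrthonormalBasis.coe_toBasis_repr_apply,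
      ContinuousLinearMap.coe_coe, OrthonormalBasis.repr_apply_apply, axial_apply, ← hbj,
      inner_add_right, inner_smul_right, b.inner_eq_ite, Matrix.diagonal_apply, spike]
    by_cases h1 : i = i'
    · subst h1
      by_cases h2 : i = j
      · simp [h2]
      · simp [h2]
    · by_cases h2 : j = i'
      · simp [h1, h2]
      · simp [h1, h2]
  rw [← LinearMap.charpoly_toMatrix _ b.toBasis, this, Matrix.charpoly_diagonal]

theorem hasFDerivAt_norm_rpow_smul {n : ℕ} (p : ℝ) {y : Rn n} (hy : y ≠ 0) :
    HasFDerivAt (fun y : Rn n => ‖y‖ ^ (p - 2) • y)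
      (axial (‖y‖⁻¹ • y) (p - 1) (‖y‖ ^ (p - 2))) y := by
  have hy' : 0 < ‖y‖ := norm_pos_iff.2 hy
  have h1 : HasFDerivAt (fun y : Rn n => ‖y‖ ^ (p - 2))
      (((p - 2) * ‖y‖ ^ (p - 4)) • innerSL ℝ y) y := by
    have := (hasStrictFDerivAt_norm_sq y).hasFDerivAt.rpow_const (p := (p - 2) / 2)
      (by simp [hy])
    have hfun : (fun z : Rn n => ‖z‖ ^ (p - 2)) = fun z => (‖z‖ ^ 2) ^ ((p - 2) / 2) := by
      ext z
      rw [← Real.rpow_natCast_mul (norm_nonneg z)]; congr 1; push_cast; ring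
    rw [hfun]
    refine this.congr_fderiv ?_
    rw [← Real.rpow_natCast_mul (norm_nonneg y), ← Nat.cast_smul_eq_nsmul ℝ, smul_smul]
    congr 1
    push_cast
    rw [show (2 : ℝ) * ((p - 2) / 2 - 1) = p - 4 by ring]; ring
  refine (h1.smul (hasFDerivAt_id y)).congr_fderiv ?_
  ext1 h
  have h2 : ‖y‖ ^ (p - 4) = ‖y‖ ^ (p - 2) * (‖y‖⁻¹ * ‖y‖⁻¹) := by
    rw [show p - 4 = (p - 2) - 2 by ring, Real.rpow_sub hy' (p - 2) 2, Real.rpow_two]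
    field_simp
  rw [axial_apply]
  simp only [add_apply, smul_apply,
    ContinuousLinearMap.smulRight_apply, innerSL_apply_apply, real_inner_smul_left, h2, id,
    ContinuousLinearMap.id_apply, smul_eq_mul]
  module

theorem fderiv_pGradField {n : ℕ} (p : ℝ) {u : Rn n → ℝ} {x : Rn n} {H : Rn n →L[ℝ] Rn n}
    (hH : HasFDerivAt (∇ u) H x) (h0 : ∇ u x ≠ 0) :
    HasFDerivAt (pGradField p u)
      ((axial (‖∇ u x‖⁻¹ • ∇ u x) (p - 1) (‖∇ u x‖ ^ (p - 2))).comp H) x :=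
  (hasFDerivAt_norm_rpow_smul p h0).comp x hH

/-- Eigenvalue comparison for `D(|Du|^{p-2}Du)` at a point where `Du` is parallel to `ν` and the
Hessian lies below `e₁ ν ⊗ ν + e₂ (I - ν ⊗ ν)`. -/
theorem exists_eigenvalues_fderiv_pGradField_le {n : ℕ} {p : ℝ} (hp : 1 < p) {u : Rn n → ℝ}
    {x : Rn n} {H : Rn n →L[ℝ] Rn n} (hH : HasFDerivAt (∇ u) H x)
    (hsymm : ∀ v w, ⟪H v, w⟫ = ⟪v, H w⟫) {ν : Rn n} (hν : ‖ν‖ = 1) {c : ℝ} (hc : c ≠ 0)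
    (hgrad : ∇ u x = c • ν) {e₁ e₂ : ℝ}
    (hle : ∀ h, ⟪H h, h⟫ ≤ e₁ * ⟪ν, h⟫ ^ 2 + e₂ * (‖h‖ ^ 2 - ⟪ν, h⟫ ^ 2)) {lam : Fin n → ℝ}
    (hlam : IsEigenvalueTuple (fderiv ℝ (pGradField p u) x) lam) :
    ∃ j, ∀ i, lam i ≤ spike j ((p - 1) * |c| ^ (p - 2) * e₁) (|c| ^ (p - 2) * e₂) i := by
  have hc' : 0 < |c| := abs_pos.2 hc
  have hν0 : ν ≠ 0 := by rintro rfl; simp at hν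
  have hnorm : ‖∇ u x‖ = |c| := by rw [hgrad, norm_smul, hν, mul_one, Real.norm_eq_abs]
  have h0 : ∇ u x ≠ 0 := by rw [hgrad]; exact smul_ne_zero hc hν0
  -- The Jacobian is a positive axial operator times H, in general not symmetric. With s and a the
  -- square roots of its two parameters, Q is its square root, and QHQ is symmetric with the same
  -- characteristic polynomial.
  set s : ℝ := √(|c| ^ (p - 2)) with hs
  set a : ℝ := √(p - 1) with ha
  have hs2 : s * s = |c| ^ (p - 2) := Real.mul_self_sqrt (by positivity)
  have ha2 : a * a = p - 1 := Real.mul_self_sqrt (by linarith)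
  set Q := axial ν a s with hQ
  have haxial : axial (‖∇ u x‖⁻¹ • ∇ u x) (p - 1) (‖∇ u x‖ ^ (p - 2))
      = axial ν (p - 1) (|c| ^ (p - 2)) := by
    ext1 h
    rw [hnorm, hgrad, smul_smul, axial_apply, axial_apply, real_inner_smul_left, smul_smul]
    congr 3
    have : (|c|⁻¹ * c) * (|c|⁻¹ * c) = 1 := by
      rw [mul_mul_mul_comm, ← abs_mul_abs_self c]; field_simp
    linear_combination (p - 1 - 1) * ⟪ν, h⟫ * this
  rw [(fderiv_pGradField p hH h0).fderiv, haxial] at hlam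
  have hcomp : axial ν (p - 1) (|c| ^ (p - 2)) = Q.comp Q := by
    ext1 h
    rw [ContinuousLinearMap.comp_apply, hQ, axial_comp_axial hν, hs2, ha2]
  set N : Rn n →ₗ[ℝ] Rn n := (Q : Rn n →ₗ[ℝ] Rn n) ∘ₗ (H : Rn n →ₗ[ℝ] Rn n) ∘ₗ
    (Q : Rn n →ₗ[ℝ] Rn n) with hN
  have hQs : ∀ v w, ⟪Q v, w⟫ = ⟪v, Q w⟫ := by
    intro v w
    simp only [hQ, axial_apply, real_inner_smul_left, real_inner_smul_right, inner_add_left,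
      inner_add_right, real_inner_comm v ν]
    ring
  have hNs : N.IsSymmetric := by
    intro v w
    simp only [hN, LinearMap.comp_apply, ContinuousLinearMap.coe_coe]
    rw [hQs, hsymm, hQs]
  have hcp : N.charpoly = ∏ i, (Polynomial.X - Polynomial.C (lam i)) := by
    rw [← hlam, hcomp, hN, ← LinearMap.comp_assoc, charpoly_comp_comm]
    rfl
  have hQν : ∀ h, ⟪ν, Q h⟫ = s * a * ⟪ν, h⟫ := by
    intro h
    rw [hQ, axial_apply, inner_smul_right, inner_add_right, inner_smul_right,
      real_inner_self_eq_norm_sq, hν]; ring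
  have hQn : ∀ h, ‖Q h‖ ^ 2 - ⟪ν, Q h⟫ ^ 2 = s * s * (‖h‖ ^ 2 - ⟪ν, h⟫ ^ 2) := by
    intro h
    rw [hQν, ← real_inner_self_eq_norm_sq, ← real_inner_self_eq_norm_sq, hQ, axial_apply]
    rw [real_inner_smul_left, real_inner_smul_right, inner_add_left, inner_add_right,
      inner_add_right, real_inner_smul_left, real_inner_smul_left, real_inner_smul_right,
      real_inner_smul_right, real_inner_comm ν h, real_inner_self_eq_norm_sq,
      real_inner_self_eq_norm_sq, hν]
    ring
  refine exists_eigenvalues_le_spike hNs hν (fun h => ?_) hcp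
  have h1 : ⟪N h, h⟫ = ⟪H (Q h), Q h⟫ := by
    simp only [hN, LinearMap.comp_apply, ContinuousLinearMap.coe_coe]
    rw [hQs]
  have h2 := hle (Q h)
  rw [hQn, hQν] at h2
  rw [h1]
  refine h2.trans_eq ?_
  rw [← hs2, ← ha2]; ring

/-! ### Keller–Osserman integrals -/

theorem continuous_integral_of_continuous {F : ℝ → ℝ} (hF : Continuous F) (a : ℝ) :
    Continuous fun t => ∫ s in a..t, F s :=
  continuous_iff_continuousAt.2 fun t => (hF.integral_hasStrictDerivAt a t).hasDerivAt.continuousAt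

theorem integral_pos_of_continuous {F : ℝ → ℝ} (hF : Continuous F) (hpos : ∀ t, 0 < F t) {a b : ℝ}
    (hab : a < b) : 0 < ∫ s in a..b, F s :=
  intervalIntegral.intervalIntegral_pos_of_pos_on (hF.intervalIntegrable a b) (fun s _ => hpos s) hab

theorem continuousOn_integral_rpow {F : ℝ → ℝ} (hF : Continuous F) (hpos : ∀ t, 0 < F t) (e : ℝ) :
    ContinuousOn (fun t => (∫ s in (0 : ℝ)..t, F s) ^ e) (Ioi 0) := by
  refine ContinuousOn.rpow_const (continuous_integral_of_continuous hF 0).continuousOn fun t ht => ?_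
  exact Or.inl (integral_pos_of_continuous hF hpos ht).ne'

theorem integrableOn_iff_lintegral_ne_top {F : ℝ → ℝ} (hF : Continuous F) (hpos : ∀ t, 0 < F t)
    (e : ℝ) {t₀ : ℝ} (ht₀ : 0 < t₀) :
    IntegrableOn (fun t => (∫ s in (0 : ℝ)..t, F s) ^ e) (Ioi t₀) ↔
      ∫⁻ t in Ioi t₀, ENNReal.ofReal ((∫ s in (0 : ℝ)..t, F s) ^ e) ≠ ⊤ := by
  have hm : AEStronglyMeasurable (fun t => (∫ s in (0 : ℝ)..t, F s) ^ e)
      (volume.restrict (Ioi t₀)) :=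
    ((continuousOn_integral_rpow hF hpos e).mono (Ioi_subset_Ioi ht₀.le)).aestronglyMeasurable
      measurableSet_Ioi
  have hnn : 0 ≤ᵐ[volume.restrict (Ioi t₀)] fun t => (∫ s in (0 : ℝ)..t, F s) ^ e :=
    ae_restrict_of_forall_mem measurableSet_Ioi fun t ht =>
      Real.rpow_nonneg (integral_pos_of_continuous hF hpos (ht₀.trans ht)).le _
  rw [IntegrableOn, ← lintegral_ofReal_ne_top_iff_integrable hm hnn]

theorem not_kellerOsserman_iff {F : ℝ → ℝ} (hF : Continuous F) (hpos : ∀ t, 0 < F t) (q : ℝ) :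
    ¬ KellerOsserman F q ↔
      ∃ t₀ > 0, IntegrableOn (fun t => (∫ s in (0 : ℝ)..t, F s) ^ (-(1 / (q + 1)))) (Ioi t₀) := by
  unfold KellerOsserman
  push Not
  refine exists_congr fun t₀ => and_congr_right fun ht₀ => ?_
  rw [integrableOn_iff_lintegral_ne_top hF hpos _ ht₀]

/-- Jensen's inequality for the power κ on [0, t], obtained by integrating the tangent-line
(Bernoulli) inequality at the mean value y of F. -/
theorem integral_rpow_ge {F : ℝ → ℝ} (hF : Continuous F) (hpos : ∀ t, 0 < F t) {κ : ℝ}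
    (hκ : 1 < κ) {t : ℝ} (ht : 0 < t) :
    t ^ (1 - κ) * (∫ s in (0 : ℝ)..t, F s) ^ κ ≤ ∫ s in (0 : ℝ)..t, F s ^ κ := by
  set I := ∫ s in (0 : ℝ)..t, F s with hI
  have hIpos : 0 < I := integral_pos_of_continuous hF hpos ht
  set y := I / t with hy
  have hypos : 0 < y := by positivity
  have hpt : ∀ s, y ^ κ * (1 + κ * (F s / y - 1)) ≤ F s ^ κ := fun s => by
    have h1 := one_add_mul_self_le_rpow_one_add (s := F s / y - 1)
      (by have := div_pos (hpos s) hypos; linarith) hκ.le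
    rw [add_sub_cancel, Real.div_rpow (hpos s).le hypos.le, le_div_iff₀ (by positivity)] at h1
    linarith
  have h2 : ∫ s in (0 : ℝ)..t, y ^ κ * (1 + κ * (F s / y - 1)) = y ^ κ * t := by
    have : ∀ s, y ^ κ * (1 + κ * (F s / y - 1)) = y ^ κ * (1 - κ) + (y ^ κ * κ / y) * F s :=
      fun s => by field_simp; ring
    simp_rw [this]
    rw [intervalIntegral.integral_add (by simp) ((hF.const_mul _).intervalIntegrable _ _),
      intervalIntegral.integral_const_mul, intervalIntegral.integral_const_mul, ← hI]
    simp only [intervalIntegral.integral_const, smul_eq_mul, sub_zero]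
    have : I = y * t := by rw [hy]; field_simp
    rw [this]; field_simp; ring
  have h3 : t ^ (1 - κ) * I ^ κ = y ^ κ * t := by
    rw [hy, Real.div_rpow hIpos.le ht.le, Real.rpow_sub ht, Real.rpow_one]; ring
  rw [h3, ← h2]
  refine intervalIntegral.integral_mono_on ht.le ?_ ?_ fun s _ => hpt s
  · exact Continuous.intervalIntegrable (by fun_prop) _ _
  · exact (hF.rpow_const fun s => Or.inl (hpos s).ne').intervalIntegrable _ _

/-- The Keller–Osserman condition for a power `F^κ`, `κ > 1`, implies the one for `F`. -/
theorem KellerOsserman.of_rpow {F : ℝ → ℝ} (hF : Continuous F) (hpos : ∀ t, 0 < F t)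
    {κ q : ℝ} (hκ : 1 < κ) (hq : 0 < q) (h : KellerOsserman (fun s => F s ^ κ) (κ * q)) :
    KellerOsserman F q := by
  by_contra hcon
  have hFκ : Continuous fun s => F s ^ κ := hF.rpow_const fun s => Or.inl (hpos s).ne'
  refine (not_kellerOsserman_iff hFκ (fun s => Real.rpow_pos_of_pos (hpos s) κ) (κ * q)).2 ?_ h
  obtain ⟨t₀, ht₀, hint⟩ := (not_kellerOsserman_iff hF hpos q).1 hcon
  set I : ℝ → ℝ := fun t => ∫ s in (0 : ℝ)..t, F s with hI
  have hIpos : ∀ t, 0 < t → 0 < I t := fun t ht => integral_pos_of_continuous hF hpos ht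
  have hImono : ∀ s t, s ≤ t → I s ≤ I t := fun s t hst => by
    have := intervalIntegral.integral_add_adjacent_intervals (hF.intervalIntegrable 0 s)
      (hF.intervalIntegrable s t) (μ := volume)
    have h2 : 0 ≤ ∫ x in s..t, F x :=
      intervalIntegral.integral_nonneg hst fun x _ => (hpos x).le
    simp only [hI]; linarith
  set e := 1 / (q + 1) with he
  have he0 : 0 < e := by positivity
  set C := ∫ t in Ioi t₀, I t ^ (-e) with hC
  have hnn : ∀ t ∈ Ioi t₀, 0 ≤ I t ^ (-e) := fun t ht =>
    Real.rpow_nonneg (hIpos t (ht₀.trans ht)).le _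
  -- The integrand decreases, so its value at t times t/2 is at most its integral over (t/2, t].
  -- This forces I to grow at least like t^(q+1).
  have hCbd : ∀ t, 2 * t₀ < t → t / 2 * I t ^ (-e) ≤ C := by
    intro t ht
    have hsub : Ioc (t / 2) t ⊆ Ioi t₀ := fun s hs => by
      have := hs.1; simp only [mem_Ioi]; linarith
    have h1 : ∫ s in Ioc (t / 2) t, I t ^ (-e) ≤ ∫ s in Ioc (t / 2) t, I s ^ (-e) := by
      refine setIntegral_mono_on (by simp) (hint.mono_set hsub) measurableSet_Ioc fun s hs => ?_
      exact Real.rpow_le_rpow_of_nonpos (hIpos s (ht₀.trans (hsub hs))) (hImono _ _ hs.2)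
        (by linarith)
    have h2 : ∫ s in Ioc (t / 2) t, I s ^ (-e) ≤ C :=
      setIntegral_mono_set hint (ae_restrict_of_forall_mem measurableSet_Ioi hnn)
        hsub.eventuallyLE
    have h3 : ∫ s in Ioc (t / 2) t, I t ^ (-e) = t / 2 * I t ^ (-e) := by
      rw [setIntegral_const, Real.volume_real_Ioc_of_le (by linarith), smul_eq_mul]
      ring
    linarith
  have hCpos : 0 < C := by
    have h1 := hCbd (3 * t₀) (by linarith)
    have := Real.rpow_pos_of_pos (hIpos (3 * t₀) (by linarith)) (-e)
    exact lt_of_lt_of_le (by positivity) h1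
  set c := (2 * C) ^ (-(q + 1)) with hc
  have hcpos : 0 < c := by positivity
  have hIge : ∀ t, 2 * t₀ < t → c * t ^ (q + 1) ≤ I t := by
    intro t ht
    have ht' : 0 < t := by linarith
    have hIt := hIpos t ht'
    have h1 := hCbd t ht
    rw [Real.rpow_neg hIt.le] at h1
    have hIe := Real.rpow_pos_of_pos hIt e
    have h2 : t / (2 * C) ≤ I t ^ e := by
      rw [div_le_iff₀ (by positivity)]
      rw [← div_eq_mul_inv, div_le_iff₀ hIe] at h1
      linarith
    have h3 := Real.rpow_le_rpow (by positivity) h2 (show 0 ≤ q + 1 by linarith)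
    rw [← Real.rpow_mul hIt.le, he, one_div_mul_cancel (by linarith), Real.rpow_one,
      Real.div_rpow ht'.le (by positivity)] at h3
    rw [hc, Real.rpow_neg (by positivity)]
    rwa [div_eq_inv_mul] at h3
  refine ⟨2 * t₀, by linarith, ?_⟩
  set r := c ^ ((κ - 1) / (q + 1)) with hr
  have hrpos : 0 < r := by positivity
  have hθ : 0 < κ * q + 1 := by positivity
  set e' := 1 / (κ * q + 1) with he'
  -- Jensen gives t^(1-κ) I^κ; the growth of I lets t^(κ-1) be paid for by I^((κ-1)/(q+1)), leaving
  -- the exponent κ - (κ-1)/(q+1) = (κq+1)/(q+1). Raised to the power -1/(κq+1) it gives back the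
  -- integrable I^(-1/(q+1)).
  have hlow : ∀ t, 2 * t₀ < t → r * I t ^ ((κ * q + 1) / (q + 1)) ≤ ∫ s in (0 : ℝ)..t, F s ^ κ := by
    intro t ht
    have ht' : 0 < t := by linarith
    have hIt := hIpos t ht'
    refine le_trans ?_ (integral_rpow_ge hF hpos hκ ht')
    have h1 : r * t ^ (κ - 1) ≤ I t ^ ((κ - 1) / (q + 1)) := by
      have := Real.rpow_le_rpow (by positivity) (hIge t ht)
        (show 0 ≤ (κ - 1) / (q + 1) from div_nonneg (by linarith) (by linarith))
      rwa [Real.mul_rpow hcpos.le (by positivity), ← Real.rpow_mul ht'.le,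
        mul_div_cancel₀ _ (show q + 1 ≠ 0 by positivity)] at this
    have h2 : I t ^ κ = I t ^ ((κ - 1) / (q + 1)) * I t ^ ((κ * q + 1) / (q + 1)) := by
      rw [← Real.rpow_add hIt]; congr 1; field_simp; ring
    have h3 : t ^ (1 - κ) * t ^ (κ - 1) = 1 := by
      rw [← Real.rpow_add ht']; simp
    change _ ≤ t ^ (1 - κ) * I t ^ κ
    have h4 := Real.rpow_pos_of_pos ht' (1 - κ)
    have h5 := Real.rpow_pos_of_pos hIt ((κ * q + 1) / (q + 1))
    rw [h2]
    calc r * I t ^ ((κ * q + 1) / (q + 1))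
        = t ^ (1 - κ) * (r * t ^ (κ - 1) * I t ^ ((κ * q + 1) / (q + 1))) := by
          linear_combination (-(r * I t ^ ((κ * q + 1) / (q + 1)))) * h3
      _ ≤ _ := by gcongr
  have hdom : IntegrableOn (fun t => r ^ (-e') * I t ^ (-e)) (Ioi (2 * t₀)) :=
    (hint.mono_set (Ioi_subset_Ioi (by linarith))).const_mul _
  refine Integrable.mono' hdom ?_ ?_
  · exact ((continuousOn_integral_rpow hFκ (fun s => Real.rpow_pos_of_pos (hpos s) κ) _).mono
      (Ioi_subset_Ioi (by linarith))).aestronglyMeasurable measurableSet_Ioi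
  · refine ae_restrict_of_forall_mem measurableSet_Ioi fun t ht => ?_
    have ht' : 0 < t := by have : 2 * t₀ < t := ht; linarith
    have hIt := hIpos t ht'
    have hpos' := integral_pos_of_continuous hFκ (fun s => Real.rpow_pos_of_pos (hpos s) κ) ht'
    rw [Real.norm_of_nonneg (Real.rpow_nonneg hpos'.le _)]
    have h1 := Real.rpow_le_rpow_of_nonpos (z := -e') (by positivity) (hlow t ht)
      (by rw [neg_nonpos]; positivity)
    rw [Real.mul_rpow hrpos.le (by positivity), ← Real.rpow_mul hIt.le] at h1
    convert h1 using 3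
    rw [he, he']; field_simp

/-- Divergence in the form needed to show that the time function of the ODE is unbounded. -/
theorem KellerOsserman.exists_integral_gt {F : ℝ → ℝ} (hF : Continuous F) (hpos : ∀ t, 0 < F t)
    {q : ℝ} (h : KellerOsserman F q) (M : ℝ) :
    ∃ s > 1, M < ∫ t in (1 : ℝ)..s, (∫ τ in (0 : ℝ)..t, F τ) ^ (-(1 / (q + 1))) := by
  by_contra! hcon
  have hcont : ContinuousOn (fun t => (∫ τ in (0 : ℝ)..t, F τ) ^ (-(1 / (q + 1)))) (Ioi 0) :=
    continuousOn_integral_rpow hF hpos _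
  refine (integrableOn_iff_lintegral_ne_top hF hpos (-(1 / (q + 1))) one_pos).1 ?_ (h 1 one_pos)
  refine integrableOn_Ioi_of_intervalIntegral_norm_bounded M 1 (l := atTop) (b := id) (fun s => ?_)
    tendsto_id ?_
  · refine ((hcont.mono fun t ht => ?_).integrableOn_Icc (a := 1) (b := s)).mono_set
      Ioc_subset_Icc_self
    have := ht.1
    simp only [mem_Ioi]; linarith
  · filter_upwards [eventually_gt_atTop 1] with s hs
    refine le_trans (le_of_eq ?_) (hcon s hs)
    refine intervalIntegral.integral_congr fun t ht => ?_
    rw [id, uIcc_of_le hs.le] at ht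
    exact Real.norm_of_nonneg (Real.rpow_nonneg
      (integral_pos_of_continuous hF hpos (by linarith [ht.1])).le _)

/-- If the Keller–Osserman condition fails, the associated integral converges from any base
point. -/
theorem integrableOn_of_not_kellerOsserman {F : ℝ → ℝ} (hF : Continuous F) (hpos : ∀ t, 0 < F t)
    (hmono : Monotone F) {q : ℝ} (hq : 0 < q) (h : ¬ KellerOsserman F q) (A : ℝ) :
    IntegrableOn (fun t => (∫ s in (0 : ℝ)..t, F (A + s)) ^ (-(1 / (q + 1)))) (Ioi 0) := by
  obtain ⟨t₀, ht₀, hint⟩ := (not_kellerOsserman_iff hF hpos q).1 h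
  set e := 1 / (q + 1) with he
  have he0 : 0 < e := by positivity
  have he1 : e < 1 := by rw [he, div_lt_one (by linarith)]; linarith
  have hFA : Continuous fun s => F (A + s) := hF.comp (by fun_prop)
  have hFApos : ∀ s, 0 < F (A + s) := fun s => hpos _
  have hmeas : ∀ S ⊆ Ioi (0 : ℝ), MeasurableSet S →
      AEStronglyMeasurable (fun t => (∫ s in (0 : ℝ)..t, F (A + s)) ^ (-e))
        (volume.restrict S) := fun S hS hSm =>
    ((continuousOn_integral_rpow hFA hFApos _).mono hS).aestronglyMeasurable hSm
  set t₁ := t₀ + |A| with ht₁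
  have ht₁pos : 0 < t₁ := by positivity
  rw [← Ioc_union_Ioi_eq_Ioi ht₁pos.le]
  refine IntegrableOn.union ?_ ?_
  -- Near 0 the inner integral is at least F(A) t, and t^(-e) is integrable because e < 1.
  · have hdom : IntegrableOn (fun t => F A ^ (-e) * t ^ (-e)) (Ioc 0 t₁) :=
      ((intervalIntegrable_iff_integrableOn_Ioc_of_le ht₁pos.le).1
        (intervalIntegral.intervalIntegrable_rpow' (by linarith))).const_mul _
    refine Integrable.mono' hdom (hmeas _ (fun t ht => ht.1) measurableSet_Ioc) ?_
    refine ae_restrict_of_forall_mem measurableSet_Ioc fun t ht => ?_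
    have hJ := integral_pos_of_continuous hFA hFApos ht.1
    rw [Real.norm_of_nonneg (Real.rpow_nonneg hJ.le _), ← Real.mul_rpow (hpos A).le ht.1.le]
    refine Real.rpow_le_rpow_of_nonpos (mul_pos (hpos A) ht.1) ?_ (by linarith)
    have : ∫ s in (0 : ℝ)..t, F A ≤ ∫ s in (0 : ℝ)..t, F (A + s) :=
      intervalIntegral.integral_mono_on ht.1.le (by simp) (hFA.intervalIntegrable _ _)
        fun s hs => hmono (by linarith [hs.1])
    simpa [mul_comm] using this
  -- Away from 0, monotonicity and a shift by |A| compare with the given convergent integral.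
  · have hdom : IntegrableOn (fun t => (∫ s in (0 : ℝ)..(t - |A|), F s) ^ (-e)) (Ioi t₁) := by
      have h2 := (measurePreserving_sub_right volume |A|).integrableOn_comp_preimage
        (MeasurableEquiv.subRight |A|).measurableEmbedding
        (f := fun t => (∫ s in (0 : ℝ)..t, F s) ^ (-e)) (s := Ioi t₀)
      have h3 : (fun x => x - |A|) ⁻¹' Ioi t₀ = Ioi t₁ := by
        ext x; simp [ht₁]
      rw [h3] at h2
      exact h2.2 hint
    refine Integrable.mono' hdom (hmeas _ (fun t ht => ht₁pos.trans ht) measurableSet_Ioi) ?_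
    refine ae_restrict_of_forall_mem measurableSet_Ioi fun t ht => ?_
    have htt : t₀ + |A| < t := ht
    have hJ := integral_pos_of_continuous hFA hFApos (ht₁pos.trans ht)
    rw [Real.norm_of_nonneg (Real.rpow_nonneg hJ.le _)]
    refine Real.rpow_le_rpow_of_nonpos (integral_pos_of_continuous hF hpos (by linarith)) ?_
      (by linarith)
    have h4 : ∫ s in (0 : ℝ)..(t - |A|), F s ≤ ∫ s in (0 : ℝ)..(t - |A|), F (A + (s + |A|)) :=
      intervalIntegral.integral_mono_on (by linarith) (hF.intervalIntegrable _ _)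
        (Continuous.intervalIntegrable (by fun_prop) _ _)
        fun s _ => hmono (by linarith [neg_abs_le A])
    have h5 : ∫ s in (0 : ℝ)..(t - |A|), F (A + (s + |A|)) = ∫ s in |A|..t, F (A + s) := by
      rw [intervalIntegral.integral_comp_add_right (fun s => F (A + s))]; simp
    have h6 := intervalIntegral.integral_add_adjacent_intervals (hFA.intervalIntegrable 0 |A|)
      (hFA.intervalIntegrable |A| t) (μ := volume)
    have h7 : 0 ≤ ∫ s in (0 : ℝ)..|A|, F (A + s) :=
      intervalIntegral.integral_nonneg (abs_nonneg A) fun x _ => (hFApos x).le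
    linarith

/-! ### The radial inequality and the first integral of its ODE -/

/-- The subsolution inequality for a radial profile with slope `w` and second derivative `w₂`,
divided by the common factor `r ^ (-(n - k) / k) w ^ (β n / k)`. -/
theorem radial_inequality_iff {n k : ℕ} (hk : 1 ≤ k) (hkn : k ≤ n) {p α β r w w₂ y : ℝ}
    (hr : 0 < r) (hw : 0 < w) (hy : 0 < y)
    (hpos : 0 < (p - 1) * w ^ (p - 2) * w₂ + ((k : ℝ) - 1) * (w ^ (p - 1) / r)) :
    r ^ α * w ^ β * y ≤
        ((p - 1) * w ^ (p - 2) * w₂ + ((k : ℝ) - 1) * (w ^ (p - 1) / r)) ^ ((k : ℝ) / n) *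
          (k * (w ^ (p - 1) / r)) ^ (((n : ℝ) - k) / n) ↔
      r ^ (n * (α + 1) / k - 1) * y ^ ((n : ℝ) / k) ≤
        (k : ℝ) ^ (((n : ℝ) - k) / k) * ((p - 1) * w ^ (n * (p - β - 1) / k - 1) * w₂ +
          ((k : ℝ) - 1) * (w ^ (n * (p - β - 1) / k) / r)) := by
  have hk' : (0 : ℝ) < k := by exact_mod_cast hk
  have hn' : (0 : ℝ) < n := by exact_mod_cast (hk.trans hkn)
  set D := (p - 1) * w ^ (p - 2) * w₂ + ((k : ℝ) - 1) * (w ^ (p - 1) / r) with hD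
  set s : ℝ := ((n : ℝ) - k) / k with hs
  -- X is what remains of both brackets once their powers of w are taken out, so only exponents have
  -- to be matched.
  set X : ℝ := (p - 1) * w⁻¹ * w₂ + ((k : ℝ) - 1) / r with hX
  have hDX : D = w ^ (p - 1) * X := by
    rw [hD, hX, show p - 2 = (p - 1) - 1 by ring, Real.rpow_sub_one hw.ne']
    ring
  have hR : (p - 1) * w ^ (n * (p - β - 1) / k - 1) * w₂ +
      ((k : ℝ) - 1) * (w ^ (n * (p - β - 1) / k) / r) = w ^ (n * (p - β - 1) / k) * X := by
    rw [hX, Real.rpow_sub_one hw.ne']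
    ring
  have hz : 0 < (n : ℝ) / k := by positivity
  rw [hR, ← Real.rpow_le_rpow_iff (by positivity) (by positivity) hz]
  have hA : (r ^ α * w ^ β * y) ^ ((n : ℝ) / k) =
      r ^ (n * (α + 1) / k - 1) * y ^ ((n : ℝ) / k) * (w ^ (β * n / k) * r ^ (-s)) := by
    rw [Real.mul_rpow (by positivity) hy.le, Real.mul_rpow (by positivity) (by positivity),
      ← Real.rpow_mul hr.le, ← Real.rpow_mul hw.le,
      show α * ((n : ℝ) / k) = (n * (α + 1) / k - 1) + -s by rw [hs]; field_simp; ring,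
      Real.rpow_add hr, ← mul_div_assoc β]
    ring
  have hB : (D ^ ((k : ℝ) / n) * (k * (w ^ (p - 1) / r)) ^ (((n : ℝ) - k) / n)) ^ ((n : ℝ) / k) =
      (k : ℝ) ^ s * (w ^ (n * (p - β - 1) / k) * X) * (w ^ (β * n / k) * r ^ (-s)) := by
    rw [Real.mul_rpow (by positivity) (by positivity), ← Real.rpow_mul hpos.le,
      ← Real.rpow_mul (by positivity), show (k : ℝ) / n * (n / k) = 1 by field_simp,
      show ((n : ℝ) - k) / n * (n / k) = s by rw [hs]; field_simp, Real.rpow_one,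
      Real.mul_rpow hk'.le (by positivity), Real.div_rpow (by positivity) hr.le,
      ← Real.rpow_mul hw.le, Real.rpow_neg hr.le, hDX]
    have h1 : w ^ (p - 1) * w ^ ((p - 1) * s) = w ^ (n * (p - β - 1) / k) * w ^ (β * n / k) := by
      rw [← Real.rpow_add hw, ← Real.rpow_add hw]
      congr 1
      rw [hs]; field_simp; ring
    linear_combination ((k : ℝ) ^ s * X / r ^ s) * h1
  rw [hA, hB]
  exact mul_le_mul_iff_of_pos_right (by positivity)

/-- Slope, as a function of the value, of the increasing solutions of `(φ' ^ q)' = lam * G'(φ)`. -/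
noncomputable def profile (q B lam : ℝ) (G : ℝ → ℝ) (s : ℝ) : ℝ :=
  (B ^ (q + 1) + lam * (1 + 1 / q) * G s) ^ (1 / (q + 1))

section Profile

variable {q B lam : ℝ} {G : ℝ → ℝ}

theorem profile_base_pos (hq : 0 < q) (hB : 0 < B) (hlam : 0 ≤ lam) (hG : ∀ s, 0 ≤ G s) (s : ℝ) :
    0 < B ^ (q + 1) + lam * (1 + 1 / q) * G s := by
  have := hG s
  positivity

theorem profile_pos (hq : 0 < q) (hB : 0 < B) (hlam : 0 ≤ lam) (hG : ∀ s, 0 ≤ G s) (s : ℝ) :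
    0 < profile q B lam G s :=
  Real.rpow_pos_of_pos (profile_base_pos hq hB hlam hG s) _

theorem profile_eq_of_eq_zero (hq : 0 < q) (hB : 0 < B) {s : ℝ} (hs : G s = 0) :
    profile q B lam G s = B := by
  rw [profile, hs, mul_zero, add_zero, ← Real.rpow_mul hB.le, mul_one_div_cancel (by positivity),
    Real.rpow_one]

theorem continuous_profile (hq : 0 < q) (hB : 0 < B) (hlam : 0 ≤ lam) (hG : ∀ s, 0 ≤ G s)
    (hGc : Continuous G) : Continuous (profile q B lam G) := by
  unfold profile
  exact Continuous.rpow_const (by fun_prop) fun s =>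
    Or.inl (profile_base_pos hq hB hlam hG s).ne'

/-- With φ' = Φ(φ) this says φ'' = lam · g · Φ / (q Φ^q), that is, (φ'^q)' = lam · g. -/
theorem hasDerivAt_profile (hq : 0 < q) (hB : 0 < B) (hlam : 0 ≤ lam) (hG : ∀ s, 0 ≤ G s)
    {s g : ℝ} (hg : HasDerivAt G g s) :
    HasDerivAt (profile q B lam G) (lam * g / (q * profile q B lam G s ^ q)) s := by
  have hb := profile_base_pos hq hB hlam hG s
  have h := ((hg.const_mul (lam * (1 + 1 / q))).const_add (B ^ (q + 1))).rpow_const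
    (p := 1 / (q + 1)) (Or.inl hb.ne')
  refine h.congr_deriv ?_
  have h1 : profile q B lam G s ^ q =
      ((B ^ (q + 1) + lam * (1 + 1 / q) * G s) ^ (1 / (q + 1) - 1))⁻¹ := by
    rw [profile, ← Real.rpow_mul hb.le, ← Real.rpow_neg hb.le]
    congr 1; field_simp; ring
  rw [h1]
  field_simp

theorem hasDerivAt_integral_inv_profile (hq : 0 < q) (hB : 0 < B) (hlam : 0 ≤ lam)
    (hG : ∀ s, 0 ≤ G s) (hGc : Continuous G) (A s : ℝ) :
    HasDerivAt (fun t => ∫ x in A..t, (profile q B lam G x)⁻¹) (profile q B lam G s)⁻¹ s :=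
  (((continuous_profile hq hB hlam hG hGc).inv₀
    fun x => (profile_pos hq hB hlam hG x).ne').integral_hasStrictDerivAt A s).hasDerivAt

theorem continuous_integral_inv_profile (hq : 0 < q) (hB : 0 < B) (hlam : 0 ≤ lam)
    (hG : ∀ s, 0 ≤ G s) (hGc : Continuous G) (A : ℝ) :
    Continuous (fun t => ∫ x in A..t, (profile q B lam G x)⁻¹) :=
  continuous_iff_continuousAt.2 fun s =>
    (hasDerivAt_integral_inv_profile hq hB hlam hG hGc A s).continuousAt

theorem strictMono_integral_inv_profile (hq : 0 < q) (hB : 0 < B) (hlam : 0 ≤ lam)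
    (hG : ∀ s, 0 ≤ G s) (hGc : Continuous G) (A : ℝ) :
    StrictMono (fun t => ∫ x in A..t, (profile q B lam G x)⁻¹) :=
  strictMono_of_hasDerivAt_pos (fun s => hasDerivAt_integral_inv_profile hq hB hlam hG hGc A s)
    fun s => inv_pos.2 (profile_pos hq hB hlam hG s)

/-- `φ' ^ q ≤ B ^ q + lam * F(φ) * t` along the solution that starts with slope `B` at `t = 0`. -/
theorem profile_rpow_le (hq : 0 < q) (hB : 0 < B) (hlam : 0 ≤ lam)
    (hG : ∀ s, 0 ≤ G s) (hGc : Continuous G) {F : ℝ → ℝ} (hF : Monotone F) {A : ℝ}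
    (hGd : ∀ s, A < s → HasDerivAt G (F s) s) (hGA : G A = 0) {s : ℝ} (hs : A ≤ s) :
    profile q B lam G s ^ q ≤ B ^ q + lam * F s * ∫ x in A..s, (profile q B lam G x)⁻¹ := by
  have hΦ := profile_pos hq hB hlam hG
  have hΦc := continuous_profile hq hB hlam hG hGc
  -- In the time variable Φ^q has derivative lam · F(τ) ≤ lam · F(s), so the difference below is
  -- nondecreasing in τ.
  have hd : ∀ τ ∈ interior (Icc A s), HasDerivAt
      (fun τ => lam * F s * (∫ x in A..τ, (profile q B lam G x)⁻¹) - profile q B lam G τ ^ q)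
      (lam * (F s - F τ) * (profile q B lam G τ)⁻¹) τ := by
    intro τ hτ
    rw [interior_Icc] at hτ
    have h1 := (hasDerivAt_integral_inv_profile hq hB hlam hG hGc A τ).const_mul (lam * F s)
    have h2 := (hasDerivAt_profile hq hB hlam hG (hGd τ hτ.1)).rpow_const (p := q)
      (Or.inl (hΦ τ).ne')
    refine (h1.sub h2).congr_deriv ?_
    have := hΦ τ
    rw [Real.rpow_sub_one this.ne']
    field_simp
  have hmono : MonotoneOn
      (fun τ => lam * F s * (∫ x in A..τ, (profile q B lam G x)⁻¹) - profile q B lam G τ ^ q)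
      (Icc A s) := by
    refine monotoneOn_of_deriv_nonneg (convex_Icc A s) ?_
      (fun τ hτ => (hd τ hτ).differentiableAt.differentiableWithinAt) fun τ hτ => ?_
    · exact (((continuous_integral_inv_profile hq hB hlam hG hGc A).const_mul _).sub
        (hΦc.rpow_const fun x => Or.inl (hΦ x).ne')).continuousOn
    · rw [(hd τ hτ).deriv]
      rw [interior_Icc] at hτ
      have h1 := hF hτ.2.le
      have h2 := hΦ τ
      have : 0 ≤ F s - F τ := by linarith
      positivity
  have := hmono ⟨le_rfl, hs⟩ ⟨hs, le_rfl⟩ hs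
  simp only [intervalIntegral.integral_same, profile_eq_of_eq_zero hq hB hGA] at this
  linarith

end Profile

/-! ### First and second order conditions at a maximum -/

theorem not_isLocalMax_of_deriv_pos_right {g g' : ℝ → ℝ}
    (hg : ∀ᶠ t in 𝓝 (0 : ℝ), HasDerivAt g (g' t) t) (hpos : ∀ᶠ t in 𝓝[>] (0 : ℝ), 0 < g' t) :
    ¬ IsLocalMax g 0 := by
  intro hmax
  obtain ⟨δ₁, hδ₁, h1⟩ := Metric.eventually_nhds_iff.1 (hg.and hmax)
  obtain ⟨δ₂, hδ₂, h2⟩ := mem_nhdsGT_iff_exists_Ioo_subset.1 hpos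
  set δ := min (δ₁ / 2) (δ₂ / 2) with hδ
  have hδ₂' : 0 < δ₂ := hδ₂
  have hδ0 : 0 < δ := by positivity
  have hin : ∀ t ∈ Icc 0 δ, dist t 0 < δ₁ := fun t ht => by
    rw [Real.dist_eq, sub_zero, abs_of_nonneg ht.1]
    have := ht.2.trans (min_le_left _ _)
    linarith
  have hmono : StrictMonoOn g (Icc 0 δ) := by
    refine strictMonoOn_of_deriv_pos (convex_Icc 0 δ)
      (fun t ht => (h1 (hin t ht)).1.continuousAt.continuousWithinAt) fun t ht => ?_
    rw [(h1 (hin t (interior_subset ht))).1.deriv]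
    rw [interior_Icc] at ht
    exact h2 ⟨ht.1, ht.2.trans_le ((min_le_right _ _).trans (by linarith))⟩
  have h3 := hmono ⟨le_rfl, hδ0.le⟩ ⟨hδ0.le, le_rfl⟩ hδ0
  exact absurd (h1 (hin δ ⟨hδ0.le, le_rfl⟩)).2 (not_le.2 h3)

theorem eventually_pos_of_hasDerivAt_pos {g : ℝ → ℝ} {c : ℝ} (hg : HasDerivAt g c 0)
    (h0 : g 0 = 0) (hc : 0 < c) : ∀ᶠ t in 𝓝[>] (0 : ℝ), 0 < g t := by
  have h1 := (hasDerivAt_iff_tendsto_slope.1 hg).eventually (lt_mem_nhds hc)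
  have h2 : ∀ᶠ t in 𝓝[>] (0 : ℝ), 0 < slope g 0 t :=
    h1.filter_mono (nhdsWithin_mono _ fun t (ht : 0 < t) => ht.ne')
  filter_upwards [h2, self_mem_nhdsWithin] with t ht ht0
  rw [slope_def_field, h0, sub_zero, sub_zero] at ht
  exact (div_pos_iff_of_pos_right ht0).1 ht

/-- A second derivative test that asks for the second derivative at the single point 0 only; it is
applied on lines through a maximum point. -/
theorem nonpos_of_isLocalMax_of_hasDerivAt {g g' : ℝ → ℝ} {c : ℝ}
    (hg : ∀ᶠ t in 𝓝 (0 : ℝ), HasDerivAt g (g' t) t) (hg' : HasDerivAt g' c 0)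
    (hmax : IsLocalMax g 0) : c ≤ 0 := by
  by_contra! hc
  exact not_isLocalMax_of_deriv_pos_right hg (eventually_pos_of_hasDerivAt_pos hg'
    (hmax.hasDerivAt_eq_zero hg.self_of_nhds) hc) hmax

theorem hasDerivAt_norm_line {n : ℕ} {x h : Rn n} {t : ℝ} (hx : x + t • h ≠ 0) :
    HasDerivAt (fun t : ℝ => ‖x + t • h‖) (⟪x + t • h, h⟫ / ‖x + t • h‖) t := by
  have h1 : HasDerivAt (fun t : ℝ => x + t • h) h t := by
    simpa using ((hasDerivAt_id t).smul_const h).const_add x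
  have h2 := h1.norm_sq.sqrt (by simpa using hx)
  simp only [Real.sqrt_sq (norm_nonneg _)] at h2
  refine h2.congr_deriv ?_
  field_simp

/-- First and second order conditions at an interior maximum of `T ∘ u - c |x|`. -/
theorem isLocalMax_comp_sub_norm {n : ℕ} {u : Rn n → ℝ} {x : Rn n} (hx : x ≠ 0)
    (hu : ∀ᶠ y in 𝓝 x, HasGradientAt u (∇ u y) y) {H : Rn n →L[ℝ] Rn n}
    (hH : HasFDerivAt (∇ u) H x) {T T₁ : ℝ → ℝ} {t₂ c : ℝ}
    (hT : ∀ᶠ s in 𝓝 (u x), HasDerivAt T (T₁ s) s) (hT₁ : HasDerivAt T₁ t₂ (u x))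
    (hmax : IsLocalMax (fun y => T (u y) - c * ‖y‖) x) :
    T₁ (u x) • ∇ u x = c • (‖x‖⁻¹ • x) ∧
      ∀ h, t₂ * ⟪∇ u x, h⟫ ^ 2 + T₁ (u x) * ⟪H h, h⟫ ≤
        c / ‖x‖ * (‖h‖ ^ 2 - ⟪‖x‖⁻¹ • x, h⟫ ^ 2) := by
  have hxn : 0 < ‖x‖ := norm_pos_iff.2 hx
  have hline : ∀ (h : Rn n) (t : ℝ), HasDerivAt (fun t : ℝ => x + t • h) h t := fun h t => by
    simpa using ((hasDerivAt_id t).smul_const h).const_add x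
  have hcont : ∀ h : Rn n, Tendsto (fun t : ℝ => x + t • h) (𝓝 0) (𝓝 x) := fun h => by
    simpa using (hline h 0).continuousAt.tendsto
  have huc : ContinuousAt u x := hu.self_of_nhds.hasFDerivAt.continuousAt
  have hmax' : ∀ h : Rn n, IsLocalMax (fun t : ℝ => T (u (x + t • h)) - c * ‖x + t • h‖) 0 := by
    intro h
    filter_upwards [(hcont h).eventually hmax] with t ht
    simpa using ht
  have hud : ∀ (h : Rn n) (t : ℝ), HasGradientAt u (∇ u (x + t • h)) (x + t • h) →
      HasDerivAt (fun t : ℝ => u (x + t • h)) ⟪∇ u (x + t • h), h⟫ t := fun h t hg => by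
    have := hg.hasFDerivAt.comp_hasDerivAt t (hline h t)
    rwa [InnerProductSpace.toDual_apply_apply] at this
  have hd : ∀ h : Rn n, ∀ᶠ t in 𝓝 (0 : ℝ),
      HasDerivAt (fun t : ℝ => T (u (x + t • h)) - c * ‖x + t • h‖)
        (T₁ (u (x + t • h)) * ⟪∇ u (x + t • h), h⟫
          - c * (⟪x + t • h, h⟫ / ‖x + t • h‖)) t := by
    intro h
    filter_upwards [(hcont h).eventually hu, (huc.tendsto.comp (hcont h)).eventually hT,
      (hcont h).eventually (isOpen_ne.mem_nhds hx)] with t h1 h2 h3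
    exact (HasDerivAt.comp t h2 (hud h t h1)).sub ((hasDerivAt_norm_line h3).const_mul c)
  refine ⟨?_, fun h => ?_⟩
  · refine ext_inner_right ℝ fun h => ?_
    have := (hmax' h).hasDerivAt_eq_zero (hd h).self_of_nhds
    simp only [zero_smul, add_zero] at this
    simp only [real_inner_smul_left]
    linear_combination this
  · have hD : HasDerivAt (fun t : ℝ => T₁ (u (x + t • h)) * ⟪∇ u (x + t • h), h⟫
        - c * (⟪x + t • h, h⟫ / ‖x + t • h‖))
        (t₂ * ⟪∇ u x, h⟫ ^ 2 + T₁ (u x) * ⟪H h, h⟫ -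
          c / ‖x‖ * (‖h‖ ^ 2 - ⟪‖x‖⁻¹ • x, h⟫ ^ 2)) 0 := by
      have hx0 : x + (0 : ℝ) • h = x := by simp
      have e1 : HasDerivAt (fun t : ℝ => u (x + t • h)) ⟪∇ u x, h⟫ 0 := by
        have := hud h 0 (by rw [hx0]; exact hu.self_of_nhds)
        rwa [hx0] at this
      have e2 : HasDerivAt (fun t : ℝ => T₁ (u (x + t • h))) (t₂ * ⟪∇ u x, h⟫) 0 :=
        HasDerivAt.comp (h₂ := T₁) 0 (by rw [hx0]; exact hT₁) e1
      have e3 : HasDerivAt (fun t : ℝ => ⟪∇ u (x + t • h), h⟫) ⟪H h, h⟫ 0 := by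
        have h1 : HasDerivAt (fun t : ℝ => ∇ u (x + t • h)) (H h) 0 :=
          HasFDerivAt.comp_hasDerivAt (l := ∇ u) 0 (by rw [hx0]; exact hH) (hline h 0)
        simpa using h1.inner ℝ (hasDerivAt_const (0 : ℝ) h)
      have e4 : HasDerivAt (fun t : ℝ => ⟪x + t • h, h⟫) (‖h‖ ^ 2) 0 := by
        simpa using (hline h 0).inner ℝ (hasDerivAt_const (0 : ℝ) h)
      have e5 := hasDerivAt_norm_line (x := x) (h := h) (t := 0) (by simpa using hx)
      have e6 := (e2.mul e3).sub ((e4.div e5 (by simpa using hx)).const_mul c)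
      refine e6.congr_deriv ?_
      simp only [hx0, real_inner_smul_left]
      field_simp
    have := nonpos_of_isLocalMax_of_hasDerivAt (hd h) hD (hmax' h)
    linarith

theorem hasGradientAt_of_contDiff {n : ℕ} {u : Rn n → ℝ} (hu : ContDiff ℝ 1 u) (x : Rn n) :
    HasGradientAt u (∇ u x) x :=
  (hu.differentiable one_ne_zero x).hasGradientAt

theorem hasFDerivAt_gradient {n : ℕ} {u : Rn n → ℝ} {x : Rn n} (hu : ContDiffAt ℝ 2 u x) :
    HasFDerivAt (∇ u) (fderiv ℝ (∇ u) x) x := by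
  have h1 : DifferentiableAt ℝ (fderiv ℝ u) x :=
    (hu.fderiv_right (m := 1) (by norm_num)).differentiableAt one_ne_zero
  exact ((InnerProductSpace.toDual ℝ (Rn n)).symm.differentiable.differentiableAt.comp x
    h1).hasFDerivAt

theorem fderiv_gradient_symm {n : ℕ} {u : Rn n → ℝ} {x : Rn n} (hu : ContDiffAt ℝ 2 u x)
    (v w : Rn n) : ⟪fderiv ℝ (∇ u) x v, w⟫ = ⟪v, fderiv ℝ (∇ u) x w⟫ := by
  have h1 : DifferentiableAt ℝ (fderiv ℝ u) x :=
    (hu.fderiv_right (m := 1) (by norm_num)).differentiableAt one_ne_zero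
  have h2 : ∀ v w, ⟪fderiv ℝ (∇ u) x v, w⟫ = fderiv ℝ (fderiv ℝ u) x v w := fun v w => by
    have e1 : HasFDerivAt (fun y => ⟪∇ u y, w⟫)
        ((innerSL ℝ w).comp (fderiv ℝ (∇ u) x)) x := by
      have := (innerSL ℝ w).hasFDerivAt.comp x (hasFDerivAt_gradient hu)
      refine this.congr_of_eventuallyEq (Eventually.of_forall fun y => ?_)
      simp
    have e2 : HasFDerivAt (fun y => fderiv ℝ u y w)
        ((fderiv ℝ (fderiv ℝ u) x).flip w) x := by
      simpa using h1.hasFDerivAt.clm_apply (hasFDerivAt_const w x)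
    have e3 : (fun y => ⟪∇ u y, w⟫) = fun y => fderiv ℝ u y w := by
      ext y; rw [inner_gradient_left]
    rw [e3] at e1
    have := congrArg (fun L => L v) (e1.unique e2)
    simpa [real_inner_comm] using this
  have hs := hu.isSymmSndFDerivAt (by simp)
  rw [h2, real_inner_comm, h2]
  exact hs.eq v w

theorem hasDerivAt_line {n : ℕ} (x h : Rn n) (t : ℝ) :
    HasDerivAt (fun t : ℝ => x + t • h) h t := by
  simpa using ((hasDerivAt_id t).smul_const h).const_add x

/-- An admissible function has no local maximum away from the origin. -/
theorem not_isLocalMax_of_admissible {n k : ℕ} (hkn : k ≤ n) {p : ℝ} {u : Rn n → ℝ}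
    (hu : ContDiff ℝ 1 u) {x : Rn n} (hd : DifferentiableAt ℝ (pGradField p u) x)
    {lam : Fin n → ℝ} (hlam : IsEigenvalueTuple (fderiv ℝ (pGradField p u) x) lam)
    (hcone : lam ∈ coneP n k) : ¬ IsLocalMax u x := by
  intro hmax
  obtain ⟨i, hi⟩ := exists_pos_of_mem_coneP hkn hcone
  set S := fderiv ℝ (pGradField p u) x with hS
  have hev : Module.End.HasEigenvalue (S : Rn n →ₗ[ℝ] Rn n) (lam i) := by
    rw [Module.End.hasEigenvalue_iff_isRoot_charpoly]
    rw [hlam, Polynomial.IsRoot.def, Polynomial.eval_prod]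
    exact Finset.prod_eq_zero (Finset.mem_univ i) (by simp)
  obtain ⟨e, he⟩ := hev.exists_hasEigenvector
  have hSe : S e = lam i • e := he.apply_eq_smul
  -- At a critical point the field vanishes, so along an eigenvector with positive eigenvalue its
  -- component becomes positive. The field is a nonnegative multiple of Du, hence u increases in
  -- that direction; no Hessian at the degenerate point enters.
  have hgrad : ∇ u x = 0 := by
    have := hmax.fderiv_eq_zero
    rw [← toDual_gradient] at this
    exact (InnerProductSpace.toDual ℝ (Rn n)).map_eq_zero_iff.1 this
  have hcont : Tendsto (fun t : ℝ => x + t • e) (𝓝 0) (𝓝 x) := by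
    simpa using (hasDerivAt_line x e 0).continuousAt.tendsto
  have hV : HasDerivAt (fun t : ℝ => ⟪pGradField p u (x + t • e), e⟫) (lam i * ‖e‖ ^ 2) 0 := by
    have h1 : HasDerivAt (fun t : ℝ => pGradField p u (x + t • e)) (S e) 0 :=
      HasFDerivAt.comp_hasDerivAt (l := pGradField p u) 0 (by simpa using hd.hasFDerivAt)
        (hasDerivAt_line x e 0)
    have h2 := h1.inner ℝ (hasDerivAt_const (0 : ℝ) e)
    rw [hSe, inner_zero_right, zero_add, real_inner_smul_left, real_inner_self_eq_norm_sq] at h2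
    exact h2
  have hpos : ∀ᶠ t in 𝓝[>] (0 : ℝ), 0 < ⟪pGradField p u (x + t • e), e⟫ := by
    refine eventually_pos_of_hasDerivAt_pos hV (by simp [pGradField, hgrad]) ?_
    have := norm_pos_iff.2 he.2
    positivity
  refine not_isLocalMax_of_deriv_pos_right (g := fun t : ℝ => u (x + t • e))
    (g' := fun t : ℝ => ⟪∇ u (x + t • e), e⟫) (Eventually.of_forall fun t => ?_) ?_ ?_
  · have := (hasGradientAt_of_contDiff hu (x + t • e)).hasFDerivAt.comp_hasDerivAt t
      (hasDerivAt_line x e t)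
    rwa [InnerProductSpace.toDual_apply_apply] at this
  · filter_upwards [hpos] with t ht
    rw [pGradField, real_inner_smul_left] at ht
    exact pos_of_mul_pos_right ht (by positivity)
  · filter_upwards [hcont.eventually hmax] with t ht
    simpa using ht

/-- `u + ε |x|` has no local maximum at the origin if `u` is differentiable there. -/
theorem not_isLocalMax_add_norm_zero {n : ℕ} [Nontrivial (Rn n)] {u : Rn n → ℝ}
    (hu : DifferentiableAt ℝ u 0) {ε : ℝ} (hε : 0 < ε) :
    ¬ IsLocalMax (fun y => u y - -ε * ‖y‖) 0 := by
  intro hmax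
  obtain ⟨e, he⟩ := exists_ne (0 : Rn n)
  have he' : 0 < ‖e‖ := norm_pos_iff.2 he
  -- The kink of ε|x| forces the derivative of u to be negative in every direction, which is absurd
  -- for both e and -e.
  have key : ∀ h : Rn n, fderiv ℝ u 0 h ≤ -ε * ‖h‖ := by
    intro h
    have h1 : HasDerivAt (fun t : ℝ => u (0 + t • h)) (fderiv ℝ u 0 h) 0 :=
      HasFDerivAt.comp_hasDerivAt (l := u) 0 (by simpa using hu.hasFDerivAt)
        (hasDerivAt_line 0 h 0)
    have hcont : Tendsto (fun t : ℝ => 0 + t • h) (𝓝 0) (𝓝 0) := by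
      simpa using (hasDerivAt_line 0 h 0).continuousAt.tendsto
    by_contra! hlt
    have h2 : HasDerivAt (fun t : ℝ => u (0 + t • h) - u 0 + ε * ‖h‖ * t)
        (fderiv ℝ u 0 h + ε * ‖h‖) 0 := by
      exact (h1.sub_const (u 0)).add (by simpa using (hasDerivAt_id (0 : ℝ)).const_mul (ε * ‖h‖))
    have h3 := eventually_pos_of_hasDerivAt_pos h2 (by simp) (by linarith)
    have h4 : ∀ᶠ t in 𝓝[>] (0 : ℝ), u (0 + t • h) - -ε * ‖0 + t • h‖ ≤ u 0 - -ε * ‖(0 : Rn n)‖ :=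
      (hcont.eventually hmax).filter_mono nhdsWithin_le_nhds
    obtain ⟨t, h5, h6, h7⟩ := (h3.and (h4.and self_mem_nhdsWithin)).exists
    have ht : 0 < t := h7
    simp only [zero_add, norm_smul, Real.norm_of_nonneg ht.le, norm_zero] at h5 h6
    nlinarith
  have h1 := key e
  have h2 := key (-e)
  rw [map_neg, norm_neg] at h2
  nlinarith

/-! ### Maxima over spheres -/

/-- The maximum of `u` on the sphere of radius `r`. -/
noncomputable def sphereMax {n : ℕ} (u : Rn n → ℝ) (r : ℝ) : ℝ :=
  sSup ((fun z => u (r • z)) '' Metric.sphere (0 : Rn n) 1)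

section SphereMax

variable {n : ℕ} {u : Rn n → ℝ}

theorem continuous_sphereMax (hu : Continuous u) : Continuous (sphereMax u) :=
  IsCompact.continuous_sSup (f := fun r z => u (r • z)) (isCompact_sphere 0 1)
    (by simp only [Function.HasUncurry.uncurry]; fun_prop)

theorem le_sphereMax (hu : Continuous u) (x : Rn n) (hx : x ≠ 0) : u x ≤ sphereMax u ‖x‖ := by
  have hx' : ‖x‖ ≠ 0 := norm_ne_zero_iff.2 hx
  refine le_csSup ((isCompact_sphere 0 1).image (by fun_prop)).bddAbove ⟨‖x‖⁻¹ • x, ?_, ?_⟩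
  · simp [norm_smul, hx']
  · simp [smul_smul, hx']

theorem exists_eq_sphereMax [Nontrivial (Rn n)] (hu : Continuous u) {r : ℝ} (hr : 0 < r) :
    ∃ x, ‖x‖ = r ∧ u x = sphereMax u r := by
  have hne : (Metric.sphere (0 : Rn n) 1).Nonempty := NormedSpace.sphere_nonempty.2 zero_le_one
  obtain ⟨z, hz, h⟩ := ((isCompact_sphere (0 : Rn n) 1).image
    (f := fun z => u (r • z)) (by fun_prop)).sSup_mem (hne.image _)
  refine ⟨r • z, ?_, h⟩
  rw [norm_smul, Real.norm_of_nonneg hr.le, mem_sphere_zero_iff_norm.1 hz, mul_one]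

end SphereMax

section Subsolution

variable {n k : ℕ} {p α β : ℝ} {f : ℝ → ℝ} {u : Rn n → ℝ}

theorem IsEntireSubsolution.contDiffAt (hu : IsEntireSubsolution n k p α β f u) {x : Rn n}
    (hx : x ≠ 0) : ContDiffAt ℝ 2 u x :=
  hu.contDiffOn_two.contDiffAt (isOpen_compl_singleton.mem_nhds hx)

/-- Otherwise u + ε|x| has a maximum inside the larger ball for small ε. The kink excludes the
origin; elsewhere the eigenvalues would lie below a spike with top entry 0 and negative other
entries, outside the cone. -/
theorem IsEntireSubsolution.sphereMax_le [Nontrivial (Rn n)] (hk : 1 ≤ k) (hkn : k ≤ n)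
    (hp : 1 < p) (hu : IsEntireSubsolution n k p α β f u) {r₁ r₂ : ℝ} (hr₁ : 0 < r₁)
    (hr : r₁ < r₂) : sphereMax u r₁ ≤ sphereMax u r₂ := by
  have huc := hu.contDiff_one.continuous
  by_contra! hlt
  obtain ⟨y, hy, hyM⟩ := exists_eq_sphereMax huc hr₁
  -- Chosen so that ε r₂ is half the supposed drop; the perturbation then cannot move the maximum to
  -- the outer sphere.
  set ε := (sphereMax u r₁ - sphereMax u r₂) / (2 * r₂) with hε
  have hr₂ : 0 < r₂ := hr₁.trans hr
  have hε0 : 0 < ε := div_pos (by linarith) (by linarith)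
  have hεr : ε * r₂ = (sphereMax u r₁ - sphereMax u r₂) / 2 := by rw [hε]; field_simp
  obtain ⟨x, hx, hxmax⟩ := (isCompact_closedBall (0 : Rn n) r₂).exists_isMaxOn
    ⟨0, by simp [hr₂.le]⟩ (f := fun y => u y - -ε * ‖y‖) (by fun_prop)
  have hyx : u y - -ε * ‖y‖ ≤ u x - -ε * ‖x‖ := hxmax (by simp [hy, hr.le])
  rw [hyM, hy] at hyx
  have hxr : ‖x‖ < r₂ := by
    refine lt_of_le_of_ne (by simpa using hx) fun h => ?_
    have h1 := le_sphereMax huc x (norm_ne_zero_iff.1 (by rw [h]; exact hr₂.ne'))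
    rw [h] at h1 hyx
    nlinarith
  have hloc : IsLocalMax (fun y => u y - -ε * ‖y‖) x :=
    hxmax.isLocalMax (Metric.closedBall_mem_nhds_of_mem (by simpa using hxr))
  by_cases hx0 : x = 0
  · subst hx0
    exact not_isLocalMax_add_norm_zero (hu.contDiff_one.differentiable one_ne_zero 0) hε0 hloc
  have hxn : 0 < ‖x‖ := norm_pos_iff.2 hx0
  have hν : ‖‖x‖⁻¹ • x‖ = 1 := by simp [norm_smul, hxn.ne']
  obtain ⟨hd, -, lam, hlam, hcone, -⟩ := hu.subsolution x hx0
  have hH := hasFDerivAt_gradient (hu.contDiffAt hx0)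
  obtain ⟨hg, hHle⟩ := isLocalMax_comp_sub_norm (T := id) (T₁ := fun _ => 1) (t₂ := 0) hx0
    (Eventually.of_forall (hasGradientAt_of_contDiff hu.contDiff_one)) hH
    (Eventually.of_forall hasDerivAt_id) (hasDerivAt_const _ _) hloc
  obtain ⟨j, hj⟩ := exists_eigenvalues_fderiv_pGradField_le hp hH
    (fderiv_gradient_symm (hu.contDiffAt hx0)) hν (c := -ε) (by simp [hε0.ne'])
    (by simpa using hg) (e₁ := 0) (e₂ := -ε / ‖x‖) (fun h => by simpa using hHle h) hlam
  refine spike_notMem_coneP hk hkn (by simp) ?_ (coneP_mono hcone hj)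
  exact mul_nonpos_of_nonneg_of_nonpos (by positivity)
    (div_nonpos_of_nonpos_of_nonneg (by linarith) hxn.le)

/-- Equality would make the sphere maximum constant on [r₁, r₂], and a maximum point on an
intermediate sphere would be a local maximum of u. -/
theorem IsEntireSubsolution.sphereMax_lt [Nontrivial (Rn n)] (hk : 1 ≤ k) (hkn : k ≤ n)
    (hp : 1 < p) (hu : IsEntireSubsolution n k p α β f u) {r₁ r₂ : ℝ} (hr₁ : 0 < r₁)
    (hr : r₁ < r₂) : sphereMax u r₁ < sphereMax u r₂ := by
  have huc := hu.contDiff_one.continuous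
  refine lt_of_le_of_ne (hu.sphereMax_le hk hkn hp hr₁ hr) fun heq => ?_
  obtain ⟨y, hy, hyM⟩ := exists_eq_sphereMax huc (r := (r₁ + r₂) / 2) (by linarith)
  have hy0 : y ≠ 0 := norm_ne_zero_iff.1 (by rw [hy]; linarith)
  obtain ⟨hd, -, lam, hlam, hcone, -⟩ := hu.subsolution y hy0
  refine not_isLocalMax_of_admissible hkn hu.contDiff_one hd hlam hcone ?_
  have h1 : ∀ᶠ z in 𝓝 y, r₁ < ‖z‖ :=
    continuous_norm.continuousAt.eventually (lt_mem_nhds (by simp only [hy]; linarith))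
  have h2 : ∀ᶠ z in 𝓝 y, ‖z‖ < r₂ :=
    continuous_norm.continuousAt.eventually (gt_mem_nhds (by simp only [hy]; linarith))
  filter_upwards [h1, h2] with z hz1 hz2
  calc u z ≤ sphereMax u ‖z‖ := le_sphereMax huc z (norm_ne_zero_iff.1 (by linarith))
    _ ≤ sphereMax u r₂ := hu.sphereMax_le hk hkn hp (by linarith) hz2
    _ = sphereMax u r₁ := heq.symm
    _ ≤ sphereMax u ((r₁ + r₂) / 2) := hu.sphereMax_le hk hkn hp hr₁ (by linarith)
    _ = u y := hyM.symm

end Subsolution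

/-! ### Necessity of the Keller–Osserman condition -/

/-- Somewhere in `[a, b)` a function with `M a < M b` grows at least linearly to the right. -/
theorem exists_linear_growth {M : ℝ → ℝ} (hM : Continuous M) {a b : ℝ} (hab : a < b)
    (hlt : M a < M b) :
    ∃ η > 0, ∃ r ∈ Ico a b, ∀ t ∈ Icc r b, M r + η * (t - r) ≤ M t := by
  -- Half the mean slope: a minimum point of M(t) - ηt has the required growth to its right and
  -- cannot be b.
  set η := (M b - M a) / (2 * (b - a)) with hη
  have hη0 : 0 < η := div_pos (by linarith) (by linarith)
  have hηb : η * (b - a) = (M b - M a) / 2 := by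
    have : b - a ≠ 0 := by linarith
    rw [hη]; field_simp
  obtain ⟨r, hr, hmin⟩ := (isCompact_Icc (a := a) (b := b)).exists_isMinOn ⟨a, le_rfl, hab.le⟩
    (f := fun t => M t - η * t) (by fun_prop)
  refine ⟨η, hη0, r, ⟨hr.1, lt_of_le_of_ne hr.2 fun h => ?_⟩, fun t ht => ?_⟩
  · have h1 : M r - η * r ≤ M a - η * a := hmin ⟨le_rfl, hab.le⟩
    rw [h] at h1
    nlinarith
  · have h1 : M r - η * r ≤ M t - η * t := hmin ⟨hr.1.trans ht.1, ht.2⟩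
    linarith

/-- Uniform bound for the life span of the solutions of `(φ' ^ q)' = lam * F(φ)` that start above
`A₁`. -/
theorem integral_inv_profile_le {F : ℝ → ℝ} (hF : Continuous F) (hpos : ∀ t, 0 < F t)
    (hmono : Monotone F) {q B lam A₁ A s : ℝ} (hq : 0 < q) (hB : 0 < B) (hlam : 0 < lam)
    (hA : A₁ ≤ A) {G : ℝ → ℝ} (hG : ∀ s, 0 ≤ G s) (hGc : Continuous G)
    (hGA : ∀ s, A ≤ s → G s = ∫ x in A..s, F x)
    (hint : IntegrableOn (fun t => (∫ x in (0 : ℝ)..t, F (A₁ + x)) ^ (-(1 / (q + 1)))) (Ioi 0))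
    (hs : A ≤ s) :
    ∫ x in A..s, (profile q B lam G x)⁻¹ ≤ lam ^ (-(1 / (q + 1))) *
      ∫ t in Ioi (0 : ℝ), (∫ x in (0 : ℝ)..t, F (A₁ + x)) ^ (-(1 / (q + 1))) := by
  set e := 1 / (q + 1) with he
  have he0 : 0 < e := by positivity
  set J : ℝ → ℝ := fun t => ∫ x in (0 : ℝ)..t, F (A₁ + x) with hJ
  have hFA : Continuous fun x => F (A₁ + x) := hF.comp (by fun_prop)
  have hJpos : ∀ t, 0 < t → 0 < J t := fun t ht =>
    integral_pos_of_continuous hFA (fun x => hpos _) ht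
  have hJle : ∀ t, 0 < t → J t ≤ G (A + t) := fun t ht => by
    have h1 : ∫ x in A..(A + t), F x = ∫ x in (0 : ℝ)..t, F (A + x) := by
      rw [intervalIntegral.integral_comp_add_left]; simp
    rw [hGA _ (by linarith), h1]
    exact intervalIntegral.integral_mono_on ht.le (hFA.intervalIntegrable _ _)
      ((hF.comp (by fun_prop)).intervalIntegrable _ _) fun x _ => hmono (by linarith)
  have hpt : ∀ t, 0 < t → (profile q B lam G (A + t))⁻¹ ≤ lam ^ (-e) * J t ^ (-e) := fun t ht => by
    have hb := profile_base_pos hq hB hlam.le hG (A + t)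
    rw [profile, ← Real.rpow_neg hb.le, ← Real.mul_rpow hlam.le (hJpos t ht).le]
    refine Real.rpow_le_rpow_of_nonpos (mul_pos hlam (hJpos t ht)) ?_ (by linarith)
    have h1 := hJle t ht
    have h2 := hJpos t ht
    have h3 : 0 ≤ lam * (1 / q) * G (A + t) := by have := hG (A + t); positivity
    have h4 : lam * J t ≤ lam * G (A + t) := by gcongr
    have h5 : 0 < B ^ (q + 1) := by positivity
    linarith
  have hΦc : Continuous fun x => (profile q B lam G x)⁻¹ :=
    (continuous_profile hq hB hlam.le hG hGc).inv₀ fun x => (profile_pos hq hB hlam.le hG x).ne'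
  have hL : 0 ≤ s - A := by linarith
  have h1 : ∫ x in A..s, (profile q B lam G x)⁻¹
      = ∫ t in (0 : ℝ)..(s - A), (profile q B lam G (A + t))⁻¹ := by
    rw [intervalIntegral.integral_comp_add_left (fun x => (profile q B lam G x)⁻¹)]; simp
  have hsub : Ioc 0 (s - A) ⊆ Ioi (0 : ℝ) := fun t ht => ht.1
  rw [h1, ← integral_const_mul, intervalIntegral.integral_of_le hL]
  refine (setIntegral_mono_on ?_ ((hint.mono_set hsub).const_mul _) measurableSet_Ioc
    fun t ht => hpt t ht.1).trans (setIntegral_mono_set (hint.const_mul _) ?_ hsub.eventuallyLE)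
  · exact (hΦc.comp (by fun_prop)).integrableOn_Ioc
  · refine ae_restrict_of_forall_mem measurableSet_Ioi fun t ht => ?_
    have := hJpos t ht
    simp only [Pi.zero_apply]
    positivity

/-- At an interior maximum of `T ∘ u - |x|`, where `T` inverts a solution of
`(φ' ^ q)' = lam * G'(φ)`, an admissible subsolution forces a lower bound on `lam * G'`. -/
theorem IsEntireSubsolution.weight_le_of_isLocalMax {n k : ℕ} (hk : 1 ≤ k) (hkn : k ≤ n)
    {p α β : ℝ} (hp : 1 < p) (hβ : β < p - 1) {f : ℝ → ℝ} (hf : ∀ t, 0 < f t) {u : Rn n → ℝ}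
    (hu : IsEntireSubsolution n k p α β f u) {B lam A : ℝ} {G : ℝ → ℝ} (hB : 0 < B)
    (hlam : 0 ≤ lam) (hG : ∀ s, 0 ≤ G s) (hGc : Continuous G) {x : Rn n} (hx : x ≠ 0) {g : ℝ}
    (hGd : HasDerivAt G g (u x))
    (hmax : IsLocalMax (fun y =>
      (∫ s in A..u y, (profile (n * (p - β - 1) / k) B lam G s)⁻¹) - ‖y‖) x) :
    ‖x‖ ^ (n * (α + 1) / k - 1) * f (u x) ^ ((n : ℝ) / k) ≤
      (k : ℝ) ^ (((n : ℝ) - k) / k) * ((p - 1) * (lam * g / (n * (p - β - 1) / k)) +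
        ((k : ℝ) - 1) *
          (profile (n * (p - β - 1) / k) B lam G (u x) ^ (n * (p - β - 1) / k) / ‖x‖)) := by
  have hk' : (0 : ℝ) < k := by exact_mod_cast hk
  have hn' : (0 : ℝ) < n := by exact_mod_cast (hk.trans hkn)
  set q := n * (p - β - 1) / k with hq_def
  have hq : 0 < q := div_pos (mul_pos hn' (by linarith)) hk'
  have hxn : 0 < ‖x‖ := norm_pos_iff.2 hx
  set Φ := profile q B lam G with hΦ
  have hΦpos : ∀ s, 0 < Φ s := profile_pos hq hB hlam hG
  set w := Φ (u x) with hw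
  have hw0 : 0 < w := hΦpos _
  set w₁ := lam * g / (q * w ^ q) with hw₁
  have hd := hasDerivAt_profile (B := B) hq hB hlam hG hGd
  have hν : ‖‖x‖⁻¹ • x‖ = 1 := by simp [norm_smul, hxn.ne']
  obtain ⟨-, -, mu, hmu, hcone, hineq⟩ := hu.subsolution x hx
  have hH := hasFDerivAt_gradient (hu.contDiffAt hx)
  obtain ⟨hgr, hHle⟩ := isLocalMax_comp_sub_norm (c := 1) hx
    (Eventually.of_forall (hasGradientAt_of_contDiff hu.contDiff_one)) hH
    (Eventually.of_forall (hasDerivAt_integral_inv_profile hq hB hlam hG hGc A))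
    (hd.inv (hΦpos _).ne') (by simpa using hmax)
  have hgrad : ∇ u x = w • (‖x‖⁻¹ • x) := by
    rw [one_smul] at hgr
    rw [← hgr, smul_smul, mul_inv_cancel₀ hw0.ne', one_smul]
  -- The right side is the Hessian form of the radial model φ(|x|) inverse to T, with φ' = w and φ''
  -- = w w₁.
  have hle : ∀ h, ⟪fderiv ℝ (∇ u) x h, h⟫ ≤ w * w₁ * ⟪‖x‖⁻¹ • x, h⟫ ^ 2 +
      w / ‖x‖ * (‖h‖ ^ 2 - ⟪‖x‖⁻¹ • x, h⟫ ^ 2) := by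
    intro h
    have h1 := hHle h
    rw [hgrad, real_inner_smul_left] at h1
    have h2 := mul_le_mul_of_nonneg_left h1 hw0.le
    have h3 : w * (-w₁ / w ^ 2 * (w * ⟪‖x‖⁻¹ • x, h⟫) ^ 2 + w⁻¹ * ⟪fderiv ℝ (∇ u) x h, h⟫)
        = ⟪fderiv ℝ (∇ u) x h, h⟫ - w * w₁ * ⟪‖x‖⁻¹ • x, h⟫ ^ 2 := by
      field_simp; ring
    have h4 : w * (1 / ‖x‖ * (‖h‖ ^ 2 - ⟪‖x‖⁻¹ • x, h⟫ ^ 2))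
        = w / ‖x‖ * (‖h‖ ^ 2 - ⟪‖x‖⁻¹ • x, h⟫ ^ 2) := by ring
    have h5 := h3.symm.le.trans (h2.trans_eq h4)
    linarith
  obtain ⟨j, hj⟩ := exists_eigenvalues_fderiv_pGradField_le hp hH
    (fderiv_gradient_symm (hu.contDiffAt hx)) hν hw0.ne' hgrad hle hmu
  rw [abs_of_pos hw0] at hj
  have hd₂ : w ^ (p - 2) * (w / ‖x‖) = w ^ (p - 1) / ‖x‖ := by
    rw [show p - 1 = (p - 2) + 1 by ring, Real.rpow_add_one hw0.ne']; ring
  rw [hd₂] at hj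
  have hd₂pos : 0 < w ^ (p - 1) / ‖x‖ := by positivity
  have hd₁pos := spike_pos_of_mem_coneP hk hkn (coneP_mono hcone hj)
  have h1 : ‖x‖ ^ α * w ^ β * f (u x) ≤
      PiK n k (spike j ((p - 1) * w ^ (p - 2) * (w * w₁)) (w ^ (p - 1) / ‖x‖)) ^
        (1 / (n.choose k : ℝ)) := by
    have hgn : ‖∇ u x‖ = w := by rw [hgrad, norm_smul, hν, mul_one, Real.norm_of_nonneg hw0.le]
    rw [hgn] at hineq
    exact hineq.trans (Real.rpow_le_rpow (PiK_pos hcone).le (PiK_mono hcone hj) (by positivity))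
  rw [PiK_spike_rpow hk hkn j hd₁pos hd₂pos,
    radial_inequality_iff hk hkn hxn hw0 (hf _) hd₁pos, ← hq_def] at h1
  have hwq : w ^ q ≠ 0 := by positivity
  have h2 : (p - 1) * w ^ (q - 1) * (w * w₁) = (p - 1) * (lam * g / q) := by
    rw [hw₁, Real.rpow_sub_one hw0.ne']
    field_simp
  rwa [h2] at h1

/-- An entire admissible subsolution can only exist under the Keller–Osserman condition. -/
theorem IsEntireSubsolution.kellerOsserman {n k : ℕ} (hk : 1 ≤ k) (hkn : k ≤ n)
    {p α β : ℝ} (hα : -1 < α) (hα' : α < (k : ℝ) / n - 1) (hp : 1 < p) (hβ : β < p - 1)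
    {f : ℝ → ℝ} (hf : ∀ t, 0 < f t) (hfm : Monotone f) (hfc : Continuous f) {u : Rn n → ℝ}
    (hu : IsEntireSubsolution n k p α β f u) :
    KellerOsserman (fun s => f s ^ ((n : ℝ) / k)) (n * (p - β - 1) / k) := by
  by_contra hKO
  have hk' : (0 : ℝ) < k := by exact_mod_cast hk
  have hk1 : (1 : ℝ) ≤ k := by exact_mod_cast hk
  have hn' : (0 : ℝ) < n := by exact_mod_cast (hk.trans hkn)
  have hnt : Nontrivial (Rn n) := by
    have : Nonempty (Fin n) := ⟨⟨0, hk.trans hkn⟩⟩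
    infer_instance
  have huc := hu.contDiff_one.continuous
  set F : ℝ → ℝ := fun s => f s ^ ((n : ℝ) / k) with hF
  have hFc : Continuous F := hfc.rpow_const fun s => Or.inl (hf s).ne'
  have hFpos : ∀ s, 0 < F s := fun s => Real.rpow_pos_of_pos (hf s) _
  have hFm : Monotone F := fun s t hst =>
    Real.rpow_le_rpow (hf s).le (hfm hst) (by positivity)
  set q := n * (p - β - 1) / k with hq_def
  have hq : 0 < q := div_pos (mul_pos hn' (by linarith)) hk'
  set a := n * (α + 1) / k with ha_def
  have ha0 : 0 < a := div_pos (mul_pos hn' (by linarith)) hk'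
  have ha1 : a < 1 := by
    rw [ha_def, div_lt_one hk']
    have : α + 1 < k / n := by linarith
    rw [lt_div_iff₀ hn'] at this
    linarith
  set M := sphereMax u with hM
  set A₁ := M 1 with hA₁
  set e := 1 / (q + 1) with he
  have he0 : 0 < e := by positivity
  have he1 : e < 1 := by rw [he, div_lt_one (by linarith)]; linarith
  have hint := integrableOn_of_not_kellerOsserman hFc hFpos hFm hq hKO A₁
  set C₀ := ∫ t in Ioi (0 : ℝ), (∫ x in (0 : ℝ)..t, F (A₁ + x)) ^ (-e) with hC₀
  set s₀ := (k : ℝ) ^ (((n : ℝ) - k) / k) with hs₀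
  have hs₀pos : 0 < s₀ := by positivity
  set D := s₀ * ((p - 1) / q + 2 * ((k : ℝ) - 1)) with hD
  have hDpos : 0 < D := by
    have h1 : 0 < (p - 1) / q := div_pos (by linarith) hq
    have h2 : 0 ≤ 2 * ((k : ℝ) - 1) := by linarith
    positivity
  set c₁ := 1 / (2 * D) with hc₁
  have hc₁pos : 0 < c₁ := by positivity
  -- The life span for lam = c₁ (4ρ)^(a-1) is a constant times ρ^((1-a)e), and (1-a)e < 1, so it is
  -- at most ρ for large ρ.
  obtain ⟨ρ, hρ1, hρ⟩ : ∃ ρ : ℝ, 1 ≤ ρ ∧ (c₁ * (4 * ρ) ^ (a - 1)) ^ (-e) * C₀ ≤ ρ := by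
    set σ := (1 - a) * e with hσ
    have hσ1 : σ < 1 := by
      have : (1 - a) * e < 1 * 1 := by
        apply mul_lt_mul'' <;> linarith
      linarith
    have hlim := (tendsto_rpow_neg_atTop (y := 1 - σ) (by linarith)).const_mul
      ((c₁ * 4 ^ (a - 1)) ^ (-e) * C₀)
    rw [mul_zero] at hlim
    obtain ⟨ρ, h1, h2⟩ := ((hlim.eventually (gt_mem_nhds one_pos)).and
      (eventually_ge_atTop 1)).exists
    refine ⟨ρ, h2, ?_⟩
    have hρ0 : 0 < ρ := by linarith
    have h3 : (c₁ * (4 * ρ) ^ (a - 1)) ^ (-e) = (c₁ * 4 ^ (a - 1)) ^ (-e) * ρ ^ σ := by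
      rw [Real.mul_rpow (by norm_num) hρ0.le, ← mul_assoc, Real.mul_rpow (by positivity)
        (by positivity), ← Real.rpow_mul hρ0.le]
      congr 2; rw [hσ]; ring
    have h4 : ρ ^ (-(1 - σ)) = ρ ^ σ / ρ := by
      rw [show -(1 - σ) = σ - 1 by ring, Real.rpow_sub_one hρ0.ne']
    rw [h4] at h1
    rw [h3]
    have h5 : (c₁ * 4 ^ (a - 1)) ^ (-e) * C₀ * (ρ ^ σ / ρ)
        = (c₁ * 4 ^ (a - 1)) ^ (-e) * ρ ^ σ * C₀ / ρ := by ring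
    rw [h5, div_lt_one hρ0] at h1
    exact h1.le
  have hρ0 : 0 < ρ := by linarith
  set lam := c₁ * (4 * ρ) ^ (a - 1) with hlam_def
  have hlam : 0 < lam := by positivity
  obtain ⟨η, hη, r₀, ⟨hr₀ρ, hr₀⟩, hgrow⟩ := exists_linear_growth (continuous_sphereMax huc)
    (show ρ < 2 * ρ by linarith) (hu.sphereMax_lt hk hkn hp hρ0 (by linarith))
  have hr₀pos : 0 < r₀ := by linarith
  set A := M r₀ with hA
  have hA₁A : A₁ ≤ A := by
    rcases (show (1 : ℝ) ≤ r₀ by linarith).eq_or_lt with h | h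
    · rw [hA, ← h]
    · exact hu.sphereMax_le hk hkn hp one_pos h
  -- A slope below η lets u overtake the model just beyond r₀; the second bound makes B^q negligible
  -- in the tangential term below.
  set B := min (η / 2) ((lam * F A * ρ) ^ (1 / q)) with hB_def
  have hFA := hFpos A
  have hB : 0 < B := lt_min (by linarith) (by positivity)
  have hBη : B < η := (min_le_left _ _).trans_lt (by linarith)
  have hBq : B ^ q ≤ lam * F A * ρ := by
    have h1 := Real.rpow_le_rpow hB.le (min_le_right _ _ : B ≤ (lam * F A * ρ) ^ (1 / q)) hq.le
    rwa [← Real.rpow_mul (by positivity), one_div_mul_cancel hq.ne', Real.rpow_one] at h1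
  -- Frozen at 0 below A, so that T is defined on all values of u and is linear there.
  set G : ℝ → ℝ := fun s => ∫ x in A..max s A, F x with hG_def
  have hG : ∀ s, 0 ≤ G s := fun s =>
    intervalIntegral.integral_nonneg (le_max_right _ _) fun x _ => (hFpos x).le
  have hGc : Continuous G :=
    (continuous_integral_of_continuous hFc A).comp (continuous_id.max continuous_const)
  have hGA : ∀ s, A ≤ s → G s = ∫ x in A..s, F x := fun s hs => by
    simp only [hG_def, max_eq_left hs]
  have hGA0 : G A = 0 := by rw [hGA A le_rfl, intervalIntegral.integral_same]
  have hGd : ∀ s, A < s → HasDerivAt G (F s) s := fun s hs =>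
    (hFc.integral_hasStrictDerivAt A s).hasDerivAt.congr_of_eventuallyEq <| by
      filter_upwards [lt_mem_nhds hs] with t ht using hGA t ht.le
  set T : ℝ → ℝ := fun s => ∫ x in A..s, (profile q B lam G x)⁻¹ with hT
  have hTmono : StrictMono T := strictMono_integral_inv_profile hq hB hlam.le hG hGc A
  have hTA : T A = 0 := by simp [hT]
  have hTc : Continuous T := continuous_integral_inv_profile hq hB hlam.le hG hGc A
  have hTle : ∀ s, T s ≤ ρ := fun s => by
    rcases le_total A s with hs | hs
    · exact (integral_inv_profile_le hFc hFpos hFm hq hB hlam hA₁A hG hGc hGA hint hs).trans hρ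
    · have := hTmono.monotone hs
      linarith
  obtain ⟨t, ht0, htρ, htT⟩ : ∃ t, 0 < t ∧ r₀ + t < 2 * ρ ∧ t < T (A + η * t) := by
    have h1 : HasDerivAt (fun t => T (A + η * t) - t) (B⁻¹ * η - 1) 0 := by
      have e1 : HasDerivAt (fun t : ℝ => A + η * t) η 0 := by
        simpa using ((hasDerivAt_id (0 : ℝ)).const_mul η).const_add A
      have e2 := hasDerivAt_integral_inv_profile hq hB hlam.le hG hGc A A
      rw [profile_eq_of_eq_zero hq hB hGA0] at e2
      exact (HasDerivAt.comp (h₂ := T) 0 (by simpa using e2) e1).sub (hasDerivAt_id 0)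
    have h2 : 0 < B⁻¹ * η - 1 := by
      rw [sub_pos, ← div_eq_inv_mul, one_lt_div hB]; exact hBη
    have h3 := eventually_pos_of_hasDerivAt_pos h1 (by simp [hTA]) h2
    have h4 : ∀ᶠ t in 𝓝[>] (0 : ℝ), t < 2 * ρ - r₀ :=
      nhdsWithin_le_nhds (gt_mem_nhds (by linarith))
    obtain ⟨t, h5, h6, h7⟩ := (h3.and (h4.and self_mem_nhdsWithin)).exists
    exact ⟨t, h7, by linarith, by linarith⟩
  obtain ⟨y, hy, hyM⟩ := exists_eq_sphereMax huc (r := r₀ + t) (by linarith)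
  have hyT : t < T (u y) := by
    refine htT.trans_le (hTmono.monotone ?_)
    have := hgrow (r₀ + t) ⟨by linarith, htρ.le⟩
    rw [hyM]; simpa using this
  have hK : IsCompact {x : Rn n | r₀ ≤ ‖x‖ ∧ ‖x‖ ≤ 4 * ρ} := by
    refine (isCompact_closedBall (0 : Rn n) (4 * ρ)).of_isClosed_subset ?_ fun x hx => ?_
    · exact (isClosed_le continuous_const continuous_norm).inter
        (isClosed_le continuous_norm continuous_const)
    · simpa using hx.2
  -- At y the function T(u) - |x| exceeds -r₀. On the inner sphere it is at most -r₀, since u ≤ A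
  -- there, and on the outer one at most ρ - 4ρ < -r₀. So the maximum over the annulus is interior.
  obtain ⟨x, hx, hxmax⟩ := hK.exists_isMaxOn ⟨y, by
    simp only [mem_ofPred_eq, hy]; constructor <;> linarith⟩ (f := fun y => T (u y) - ‖y‖) (by fun_prop)
  have hyx : T (u y) - ‖y‖ ≤ T (u x) - ‖x‖ :=
    hxmax (by simp only [mem_ofPred_eq, hy]; constructor <;> linarith)
  rw [hy] at hyx
  have hx0 : x ≠ 0 := norm_ne_zero_iff.1 (by linarith [hx.1])
  have hx1 : r₀ < ‖x‖ := by
    refine lt_of_le_of_ne hx.1 fun h => ?_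
    have h1 := le_sphereMax huc x hx0
    rw [← h] at h1
    have h2 := hTmono.monotone h1
    rw [hTA] at h2
    linarith
  have hx2 : ‖x‖ < 4 * ρ := by
    refine lt_of_le_of_ne hx.2 fun h => ?_
    have := hTle (u x)
    linarith
  have hux : A < u x := hTmono.lt_iff_lt.1 (by rw [hTA]; linarith)
  have hloc : IsLocalMax (fun y => T (u y) - ‖y‖) x := by
    refine hxmax.isLocalMax ?_
    filter_upwards [continuous_norm.continuousAt.eventually (lt_mem_nhds hx1),
      continuous_norm.continuousAt.eventually (gt_mem_nhds hx2)] with z h1 h2 using ⟨h1.le, h2.le⟩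
  have hmain := hu.weight_le_of_isLocalMax hk hkn hp hβ hf hB hlam.le hG hGc hx0 (hGd _ hux) hloc
  rw [← hq_def, ← ha_def, ← hs₀] at hmain
  have hFu := hFpos (u x)
  have hxpos : 0 < ‖x‖ := by linarith
  -- Both B^q and the increment lam · F(u) · T(u) are at most lam · F(u) · |x|, because T ≤ ρ ≤ |x|.
  have hprof : profile q B lam G (u x) ^ q / ‖x‖ ≤ 2 * (lam * F (u x)) := by
    have h1 := profile_rpow_le hq hB hlam.le hG hGc hFm hGd hGA0 hux.le
    have h2 : lam * F (u x) * T (u x) ≤ lam * F (u x) * ‖x‖ := by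
      gcongr; exact (hTle _).trans (by linarith)
    have h3 : lam * F A * ρ ≤ lam * F (u x) * ‖x‖ := by
      gcongr
      · exact hFm hux.le
      · linarith
    rw [div_le_iff₀ hxpos]
    linarith
  have hfin : ‖x‖ ^ (a - 1) * F (u x) ≤ D * (lam * F (u x)) := by
    refine hmain.trans ?_
    rw [hD, mul_assoc s₀]
    refine mul_le_mul_of_nonneg_left ?_ hs₀pos.le
    have h1 : ((k : ℝ) - 1) * (profile q B lam G (u x) ^ q / ‖x‖)
        ≤ ((k : ℝ) - 1) * (2 * (lam * F (u x))) :=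
      mul_le_mul_of_nonneg_left hprof (by linarith)
    have h2 : (p - 1) * (lam * F (u x) / q) = (p - 1) / q * (lam * F (u x)) := by ring
    rw [h2]
    linarith
  -- The choice of c₁ leaves half the weight at radius 4ρ, whereas |x| < 4ρ and a < 1 make the
  -- weight at x at least the full amount.
  have hDlam : D * lam = (4 * ρ) ^ (a - 1) / 2 := by
    rw [hlam_def, hc₁]; field_simp
  rw [← mul_assoc, hDlam] at hfin
  have h1 := le_of_mul_le_mul_right hfin hFu
  have h2 : (4 * ρ) ^ (a - 1) ≤ ‖x‖ ^ (a - 1) :=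
    Real.rpow_le_rpow_of_nonpos hxpos hx2.le (by linarith)
  have h3 : 0 < (4 * ρ) ^ (a - 1) := by positivity
  linarith

/-! ### The global ODE solution and the radial profile -/

/-- The excess of `F` over `F 0` on the positive half line, and `0` on the negative one. -/
noncomputable def excess (F : ℝ → ℝ) (s : ℝ) : ℝ := F (max s 0) - F 0

section Excess

variable {F : ℝ → ℝ}

theorem continuous_excess (hF : Continuous F) : Continuous (excess F) :=
  (hF.comp (continuous_id.max continuous_const)).sub continuous_const

theorem excess_nonneg (hF : Monotone F) (s : ℝ) : 0 ≤ excess F s :=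
  sub_nonneg.2 (hF (le_max_right _ _))

theorem integral_excess_of_nonpos {s : ℝ} (hs : s ≤ 0) : ∫ x in (0 : ℝ)..s, excess F x = 0 := by
  refine intervalIntegral.integral_zero_ae (Eventually.of_forall fun x hx => ?_)
  rw [uIoc_of_ge hs] at hx
  simp [excess, hx.2]

theorem integral_excess_nonneg (hF : Monotone F) (s : ℝ) : 0 ≤ ∫ x in (0 : ℝ)..s, excess F x := by
  rcases le_total s 0 with hs | hs
  · rw [integral_excess_of_nonpos hs]
  · exact intervalIntegral.integral_nonneg hs fun x _ => excess_nonneg hF x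

theorem integral_excess_le (hF : Continuous F) (hpos : ∀ t, 0 < F t) {s : ℝ} (hs : 0 ≤ s) :
    ∫ x in (0 : ℝ)..s, excess F x ≤ ∫ x in (0 : ℝ)..s, F x := by
  refine intervalIntegral.integral_mono_on hs ((continuous_excess hF).intervalIntegrable _ _)
    (hF.intervalIntegrable _ _) fun x hx => ?_
  rw [excess, max_eq_left hx.1]
  linarith [hpos 0]

end Excess

/-- Under the Keller–Osserman condition the solution `Y` of `Y' = Φ(Y)`, `Y 0 = -1`, is global. -/
theorem exists_global_solution {F : ℝ → ℝ} (hF : Continuous F) (hpos : ∀ t, 0 < F t)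
    (hmono : Monotone F) {q B lam : ℝ} (hq : 0 < q) (hB : 0 < B) (hlam : 0 ≤ lam)
    (hKO : KellerOsserman F q) :
    ∃ Y : ℝ → ℝ,
      (∀ t, HasDerivAt Y (profile q B lam (fun s => ∫ x in (0 : ℝ)..s, excess F x) (Y t)) t) ∧
      ∀ t, 0 < Y t → 1 / B < t := by
  set G : ℝ → ℝ := fun s => ∫ x in (0 : ℝ)..s, excess F x with hG_def
  have hG : ∀ s, 0 ≤ G s := integral_excess_nonneg hmono
  have hGc : Continuous G := continuous_integral_of_continuous (continuous_excess hF) 0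
  set Φ := profile q B lam G with hΦ
  have hΦpos : ∀ s, 0 < Φ s := profile_pos hq hB hlam hG
  set T : ℝ → ℝ := fun s => ∫ x in (-1 : ℝ)..s, (Φ x)⁻¹ with hT
  have hTmono : StrictMono T := strictMono_integral_inv_profile hq hB hlam hG hGc (-1)
  have hTc : Continuous T := continuous_integral_inv_profile hq hB hlam hG hGc (-1)
  have hΦc : Continuous fun x => (Φ x)⁻¹ :=
    (continuous_profile hq hB hlam hG hGc).inv₀ fun x => (hΦpos x).ne'
  have hTneg : ∀ s, s ≤ 0 → T s = (s + 1) * B⁻¹ := by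
    intro s hs
    have : T s = ∫ x in (-1 : ℝ)..s, B⁻¹ := by
      refine intervalIntegral.integral_congr fun x hx => ?_
      have hx0 : x ≤ 0 := hx.2.trans (max_le (by norm_num) hs)
      simp only [hΦ]
      rw [profile_eq_of_eq_zero (G := G) hq hB (integral_excess_of_nonpos hx0)]
    rw [this, intervalIntegral.integral_const, smul_eq_mul, sub_neg_eq_add]
  have hbot : ∀ M, ∃ s, T s < M := by
    intro M
    refine ⟨min 0 (B * (M - 1) - 1), ?_⟩
    rw [hTneg _ (min_le_left _ _)]
    have h1 : (min 0 (B * (M - 1) - 1) + 1) * B⁻¹ ≤ B * (M - 1) * B⁻¹ := by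
      gcongr
      linarith [min_le_right (0 : ℝ) (B * (M - 1) - 1)]
    have h2 : B * (M - 1) * B⁻¹ = M - 1 := by field_simp
    linarith
  have htop : ∀ M, ∃ s, M < T s := by
    intro M
    set e := 1 / (q + 1) with he
    have he0 : 0 < e := by positivity
    set I : ℝ → ℝ := fun t => ∫ x in (0 : ℝ)..t, F x with hI
    have hI1 : 0 < I 1 := integral_pos_of_continuous hF hpos one_pos
    have hIle : ∀ s, 1 ≤ s → I 1 ≤ I s := fun s hs => by
      have h1 := intervalIntegral.integral_add_adjacent_intervals (hF.intervalIntegrable 0 1)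
        (hF.intervalIntegrable 1 s) (μ := volume)
      have h2 : 0 ≤ ∫ x in (1 : ℝ)..s, F x :=
        intervalIntegral.integral_nonneg hs fun x _ => (hpos x).le
      simp only [hI]; linarith
    -- For s ≥ 1 the base of Φ is at most C · I(s), so 1/Φ dominates a multiple of the
    -- Keller–Osserman integrand.
    set C := B ^ (q + 1) / I 1 + lam * (1 + 1 / q) with hC
    have hC0 : 0 < C := by positivity
    have hlow : ∀ s, 1 ≤ s → C ^ (-e) * I s ^ (-e) ≤ (Φ s)⁻¹ := by
      intro s hs
      have hIs : 0 < I s := hI1.trans_le (hIle s hs)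
      have hb := profile_base_pos hq hB hlam hG s
      rw [← Real.mul_rpow hC0.le hIs.le]
      simp only [hΦ, profile]
      rw [← Real.rpow_neg hb.le]
      refine Real.rpow_le_rpow_of_nonpos hb ?_ (by linarith)
      have h1 : G s ≤ I s := integral_excess_le hF hpos (by linarith)
      have h2 : B ^ (q + 1) ≤ B ^ (q + 1) / I 1 * I s := by
        rw [div_mul_eq_mul_div, le_div_iff₀ hI1]
        have := hIle s hs
        gcongr
      have h3 : lam * (1 + 1 / q) * G s ≤ lam * (1 + 1 / q) * I s := by gcongr
      rw [hC, add_mul]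
      linarith
    obtain ⟨s, hs, hM⟩ := hKO.exists_integral_gt hF hpos (M / C ^ (-e))
    refine ⟨s, ?_⟩
    have hCe : 0 < C ^ (-e) := by positivity
    rw [div_lt_iff₀ hCe, mul_comm, ← intervalIntegral.integral_const_mul] at hM
    have hT1 : T s = T 1 + ∫ x in (1 : ℝ)..s, (Φ x)⁻¹ :=
      (intervalIntegral.integral_add_adjacent_intervals (hΦc.intervalIntegrable _ _)
        (hΦc.intervalIntegrable _ _)).symm
    have hT1pos : 0 ≤ T 1 := by
      have := hTmono.monotone (show (-1 : ℝ) ≤ 1 by norm_num)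
      rw [hTneg (-1) (by norm_num)] at this
      simpa using this
    have hle : ∫ x in (1 : ℝ)..s, C ^ (-e) * I x ^ (-e) ≤ ∫ x in (1 : ℝ)..s, (Φ x)⁻¹ := by
      refine intervalIntegral.integral_mono_on hs.le ?_ (hΦc.intervalIntegrable _ _)
        fun x hx => hlow x hx.1
      refine ContinuousOn.intervalIntegrable ?_
      rw [uIcc_of_le hs.le]
      exact ((continuousOn_integral_rpow hF hpos (-e)).mono fun x hx =>
        one_pos.trans_le hx.1).const_mul _
    simp only [hI] at hle
    linarith
  have hsurj : Function.Surjective T := by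
    intro M
    obtain ⟨s₁, h1⟩ := hbot M
    obtain ⟨s₂, h2⟩ := htop M
    exact mem_range_of_exists_le_of_exists_ge hTc ⟨s₁, h1.le⟩ ⟨s₂, h2.le⟩
  -- Y is the inverse of the time function T, which maps ℝ onto ℝ.
  set E := hTmono.orderIsoOfSurjective T hsurj with hE
  have hTE : ∀ t, T (E.symm t) = t := fun t => E.apply_symm_apply t
  refine ⟨E.symm, fun t => ?_, fun t ht => ?_⟩
  · have h1 := hasDerivAt_integral_inv_profile hq hB hlam hG hGc (-1) (E.symm t)
    have h2 := HasDerivAt.of_local_left_inverse (f := T) E.symm.continuous.continuousAt h1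
      (inv_ne_zero (hΦpos _).ne') (Eventually.of_forall hTE)
    rwa [inv_inv] at h2
  · have h1 := hTmono ht
    rw [hTE, hTneg 0 le_rfl] at h1
    simpa using h1

/-- The profile of the radial subsolution, as a function of `|x| ^ m` with `m = 1 + a / q`. -/
theorem exists_radial_profile {F : ℝ → ℝ} (hF : Continuous F) (hpos : ∀ t, 0 < F t)
    (hmono : Monotone F) {p q a m : ℝ} (hp : 1 < p) (hq : 0 < q) (ha : 0 < a)
    (hm : m = 1 + a / q) (hKO : KellerOsserman F q) :
    ∃ Y Y₁ Y₂ : ℝ → ℝ, (∀ t, HasDerivAt Y (Y₁ t) t) ∧ (∀ t, HasDerivAt Y₁ (Y₂ t) t) ∧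
      Continuous Y₂ ∧ (∀ t, 0 < Y₁ t) ∧ (∀ t, 0 ≤ Y₂ t) ∧
      ∀ r, 0 < r → r ^ (a - 1) * F (Y (r ^ m)) ≤
        (p - 1) * (m * r ^ (m - 1) * Y₁ (r ^ m)) ^ (q - 1) *
          (m * (m - 1) * r ^ (m - 2) * Y₁ (r ^ m) + m ^ 2 * r ^ (2 * m - 2) * Y₂ (r ^ m)) := by
  have hm1 : 1 < m := by rw [hm]; linarith [div_pos ha hq]
  have hm0 : 0 < m := by linarith
  have hp1 : 0 < p - 1 := by linarith
  have hF0 := hpos 0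
  -- B is fixed by a m^q B^q = q/(p-1) · F(0), so the minimal slope alone pays for F(0); lam is
  -- fixed by m^(q+1) lam = q/(p-1) · B, so the source term pays for the excess once B r^m ≥ 1.
  set B := (q / (p - 1) * F 0 / (a * m ^ q)) ^ (1 / q) with hB_def
  have hB : 0 < B := by positivity
  have hBq : a * m ^ q * B ^ q = q / (p - 1) * F 0 := by
    rw [hB_def, ← Real.rpow_mul (by positivity), one_div_mul_cancel hq.ne', Real.rpow_one]
    field_simp
  set lam := q / (p - 1) * B / m ^ (q + 1) with hlam_def
  have hlam : 0 < lam := by positivity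
  obtain ⟨Y, hY, hYB⟩ := exists_global_solution hF hpos hmono hq hB hlam.le hKO
  set G : ℝ → ℝ := fun s => ∫ x in (0 : ℝ)..s, excess F x with hG_def
  have hG : ∀ s, 0 ≤ G s := integral_excess_nonneg hmono
  have hGc : Continuous G := continuous_integral_of_continuous (continuous_excess hF) 0
  have hGd : ∀ s, HasDerivAt G (excess F s) s := fun s =>
    ((continuous_excess hF).integral_hasStrictDerivAt 0 s).hasDerivAt
  set Φ := profile q B lam G with hΦ
  have hΦpos : ∀ s, 0 < Φ s := profile_pos hq hB hlam.le hG
  have hΦc : Continuous Φ := continuous_profile hq hB hlam.le hG hGc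
  have hYc : Continuous Y := continuous_iff_continuousAt.2 fun t => (hY t).continuousAt
  have hΦB : ∀ s, B ≤ Φ s := fun s => by
    have h1 : (B ^ (q + 1)) ^ (1 / (q + 1)) ≤ Φ s := by
      simp only [hΦ, profile]
      refine Real.rpow_le_rpow (by positivity) ?_ (by positivity)
      have := hG s
      have : 0 ≤ lam * (1 + 1 / q) * G s := by positivity
      linarith
    rwa [← Real.rpow_mul hB.le, mul_one_div_cancel (by positivity), Real.rpow_one] at h1
  refine ⟨Y, fun t => Φ (Y t), fun t => lam * excess F (Y t) / (q * Φ (Y t) ^ q) * Φ (Y t), hY,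
    fun t => HasDerivAt.comp t (hasDerivAt_profile hq hB hlam.le hG (hGd _)) (hY t), ?_,
    fun t => hΦpos _, fun t => ?_, fun r hr => ?_⟩
  · have hΦY : Continuous fun t => Φ (Y t) := hΦc.comp hYc
    have h1 : Continuous fun t => Φ (Y t) ^ q := hΦY.rpow_const fun t => Or.inl (hΦpos _).ne'
    have h2 : Continuous fun t => excess F (Y t) := (continuous_excess hF).comp hYc
    exact ((h2.const_mul _).div (h1.const_mul _)
      fun t => by have := hΦpos (Y t); positivity).mul hΦY
  · have h1 := hΦpos (Y t)
    have h2 := excess_nonneg hmono (Y t)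
    positivity
  · set z := r ^ m with hz
    set y := Φ (Y z) with hy
    have hy0 : 0 < y := hΦpos _
    have hm1' : 0 < m - 1 := by linarith
    have hmq : (m - 1) * q = a := by rw [hm]; field_simp; ring
    have hE := excess_nonneg hmono (Y z)
    -- This is (p-1)/q times the r-derivative of (m r^(m-1) Y₁(r^m))^q = m^q r^a Y₁(r^m)^q, where
    -- (m-1)q = a.
    have hident : (p - 1) * (m * r ^ (m - 1) * y) ^ (q - 1) *
        (m * (m - 1) * r ^ (m - 2) * y + m ^ 2 * r ^ (2 * m - 2) *
          (lam * excess F (Y z) / (q * y ^ q) * y)) =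
        (p - 1) / q * r ^ (a - 1) *
          (a * m ^ q * y ^ q + m ^ (q + 1) * lam * z * excess F (Y z)) := by
      have e1 : (m * r ^ (m - 1) * y) ^ (q - 1) = m ^ q / m * r ^ (a - (m - 1)) * (y ^ q / y) := by
        rw [Real.mul_rpow (by positivity) hy0.le, Real.mul_rpow hm0.le (by positivity),
          ← Real.rpow_mul hr.le, Real.rpow_sub_one hm0.ne', Real.rpow_sub_one hy0.ne',
          show (m - 1) * (q - 1) = a - (m - 1) by rw [← hmq]; ring]
      have e2 : r ^ (a - (m - 1)) * r ^ (m - 2) = r ^ (a - 1) := by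
        rw [← Real.rpow_add hr]; congr 1; ring
      have e3 : r ^ (a - (m - 1)) * r ^ (2 * m - 2) = r ^ (a - 1) * z := by
        rw [← Real.rpow_add hr, hz, ← Real.rpow_add hr]; congr 1; ring
      have hyq : y ^ q ≠ 0 := by positivity
      have e4 : m ^ (q + 1) = m ^ q * m := Real.rpow_add_one hm0.ne' q
      rw [e1, e4]
      calc _ = (p - 1) * m ^ q * (m - 1) * y ^ q * (r ^ (a - (m - 1)) * r ^ (m - 2)) +
            (p - 1) * m ^ q * m * lam * excess F (Y z) / q *
              (r ^ (a - (m - 1)) * r ^ (2 * m - 2)) := by field_simp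
        _ = _ := by rw [e2, e3, ← hmq]; field_simp
    refine le_of_le_of_eq ?_ hident.symm
    have hpq : (p - 1) / q * (q / (p - 1)) = 1 := by field_simp
    have h1 : q / (p - 1) * F 0 ≤ a * m ^ q * y ^ q := by
      rw [← hBq]
      have := hΦB (Y z)
      gcongr
    -- The factor z = r^m is small near the origin. Starting Y at -1 delays the sign change of Y to
    -- time 1/B, so the excess is zero until B z ≥ 1.
    have h2 : q / (p - 1) * (F (Y z) - F 0) ≤ m ^ (q + 1) * lam * z * excess F (Y z) := by
      rcases le_or_gt (Y z) 0 with h | h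
      · have h3 : F (Y z) - F 0 ≤ 0 := sub_nonpos.2 (hmono h)
        have hz0 : 0 < z := by positivity
        calc q / (p - 1) * (F (Y z) - F 0) ≤ 0 :=
              mul_nonpos_of_nonneg_of_nonpos (by positivity) h3
          _ ≤ _ := by positivity
      · have h3 : 1 ≤ B * z := by
          have := hYB z h
          rw [div_lt_iff₀ hB] at this
          linarith
        have h4 : excess F (Y z) = F (Y z) - F 0 := by rw [excess, max_eq_left h.le]
        rw [h4] at hE ⊢
        have h5 : m ^ (q + 1) * lam = q / (p - 1) * B := by rw [hlam_def]; field_simp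
        rw [h5]
        calc q / (p - 1) * (F (Y z) - F 0) = q / (p - 1) * 1 * (F (Y z) - F 0) := by ring
          _ ≤ q / (p - 1) * (B * z) * (F (Y z) - F 0) := by gcongr
          _ = _ := by ring
    calc r ^ (a - 1) * F (Y z)
        = (p - 1) / q * r ^ (a - 1) *
            (q / (p - 1) * F 0 + q / (p - 1) * (F (Y z) - F 0)) := by
          linear_combination (-(r ^ (a - 1) * F (Y z))) * hpq
      _ ≤ _ := by gcongr

/-! ### Regularity of |x|^m and of radial functions -/

theorem norm_axial_le {n : ℕ} {ν : Rn n} (hν : ‖ν‖ = 1) (a s : ℝ) :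
    ‖axial ν a s‖ ≤ |s| * (1 + |a - 1|) := by
  refine ContinuousLinearMap.opNorm_le_bound _ (by positivity) fun h => ?_
  have h1 : |⟪ν, h⟫| ≤ ‖h‖ := by
    have := abs_real_inner_le_norm ν h
    rwa [hν, one_mul] at this
  rw [axial_apply, norm_smul, Real.norm_eq_abs, mul_assoc]
  gcongr
  calc ‖h + ((a - 1) * ⟪ν, h⟫) • ν‖ ≤ ‖h‖ + |a - 1| * |⟪ν, h⟫| := by
        refine (norm_add_le _ _).trans ?_
        rw [norm_smul, hν, mul_one, Real.norm_eq_abs, abs_mul]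
    _ ≤ ‖h‖ + |a - 1| * ‖h‖ := by gcongr
    _ = _ := by ring

/-- The map `x ↦ |x| ^ (m - 2) x` is continuously differentiable for `m ≥ 2`. -/
theorem contDiff_norm_rpow_smul {n : ℕ} {m : ℝ} (hm : 2 ≤ m) :
    ContDiff ℝ 1 (fun x : Rn n => ‖x‖ ^ (m - 2) • x) := by
  rcases hm.eq_or_lt with rfl | hm
  · simpa using! contDiff_id
  have hzero : HasFDerivAt (fun x : Rn n => ‖x‖ ^ (m - 2) • x) (0 : Rn n →L[ℝ] Rn n) 0 := by
    rw [hasFDerivAt_iff_isLittleO_nhds_zero]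
    have h1 : (fun h : Rn n => ‖h‖ ^ (m - 2)) =o[𝓝 0] fun _ => (1 : ℝ) := by
      rw [Asymptotics.isLittleO_one_iff]
      have : ContinuousAt (fun h : Rn n => ‖h‖ ^ (m - 2)) 0 :=
        continuousAt_id.norm.rpow_const (Or.inr (by linarith))
      have h2 := this.tendsto
      rwa [norm_zero, Real.zero_rpow (by linarith)] at h2
    simpa using h1.smul_isBigO (Asymptotics.isBigO_refl (fun h : Rn n => h) (𝓝 0))
  have hd : ∀ x : Rn n, DifferentiableAt ℝ (fun x : Rn n => ‖x‖ ^ (m - 2) • x) x := fun x => by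
    by_cases hx : x = 0
    · rw [hx]; exact hzero.differentiableAt
    · exact (hasFDerivAt_norm_rpow_smul m hx).differentiableAt
  rw [contDiff_one_iff_fderiv]
  refine ⟨hd, continuous_iff_continuousAt.2 fun x => ?_⟩
  by_cases hx : x = 0
  · subst hx
    rw [ContinuousAt, hzero.fderiv, tendsto_zero_iff_norm_tendsto_zero]
    have hlim : Tendsto (fun x : Rn n => ‖x‖ ^ (m - 2) * (1 + |m - 1 - 1|)) (𝓝 0) (𝓝 0) := by
      have : ContinuousAt (fun h : Rn n => ‖h‖ ^ (m - 2) * (1 + |m - 1 - 1|)) 0 :=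
        (continuousAt_id.norm.rpow_const (Or.inr (by linarith))).mul continuousAt_const
      have h2 := this.tendsto
      rwa [norm_zero, Real.zero_rpow (by linarith), zero_mul] at h2
    refine squeeze_zero (fun _ => norm_nonneg _) (fun x => ?_) hlim
    by_cases hx : x = 0
    · rw [hx, hzero.fderiv, norm_zero]; positivity
    · have hxn : 0 < ‖x‖ := norm_pos_iff.2 hx
      rw [(hasFDerivAt_norm_rpow_smul m hx).fderiv]
      have hν : ‖‖x‖⁻¹ • x‖ = 1 := by simp [norm_smul, hxn.ne']
      refine (norm_axial_le hν _ _).trans_eq ?_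
      rw [abs_of_nonneg (by positivity)]
  · have h1 : ContDiffAt ℝ 2 (fun x : Rn n => ‖x‖ ^ (m - 2) • x) x :=
      ((contDiffAt_norm ℝ hx).rpow_const_of_ne (norm_ne_zero_iff.2 hx)).smul contDiffAt_id
    exact (h1.fderiv_right (m := 1) (by norm_num)).continuousAt

theorem contDiff_two_norm_rpow {n : ℕ} {m : ℝ} (hm : 2 ≤ m) :
    ContDiff ℝ 2 (fun x : Rn n => ‖x‖ ^ m) := by
  have h1 : ContDiff ℝ (1 + 1) (fun x : Rn n => ‖x‖ ^ m) := by
    refine (contDiff_succ_iff_hasFDerivAt (n := 1)).2 ?_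
    refine ⟨fun x => m • innerSL ℝ (‖x‖ ^ (m - 2) • x), ?_, fun x => ?_⟩
    · exact ((innerSL ℝ).contDiff.comp (contDiff_norm_rpow_smul hm)).const_smul m
    · refine (hasFDerivAt_norm_rpow x (show 1 < m by linarith)).congr_fderiv ?_
      simp only [map_smul, smul_smul]
  exact h1

section RadialPower

variable {n : ℕ} {m : ℝ} {Y Y₁ Y₂ : ℝ → ℝ}

theorem contDiff_two_of_hasDerivAt (hY : ∀ t, HasDerivAt Y (Y₁ t) t)
    (hY₁ : ∀ t, HasDerivAt Y₁ (Y₂ t) t) (hY₂ : Continuous Y₂) : ContDiff ℝ 2 Y := by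
  have e1 : deriv Y = Y₁ := funext fun t => (hY t).deriv
  have e2 : deriv Y₁ = Y₂ := funext fun t => (hY₁ t).deriv
  have h1 : ContDiff ℝ 1 Y₁ :=
    contDiff_one_iff_deriv.2 ⟨fun t => (hY₁ t).differentiableAt, e2 ▸ hY₂⟩
  exact contDiff_succ_iff_deriv (n := 1).2
    ⟨fun t => (hY t).differentiableAt, by simp, e1 ▸ h1⟩

theorem hasGradientAt_radial (hm : 1 < m) (hY : ∀ t, HasDerivAt Y (Y₁ t) t) (x : Rn n) :
    HasGradientAt (fun x : Rn n => Y (‖x‖ ^ m)) ((m * Y₁ (‖x‖ ^ m)) • (‖x‖ ^ (m - 2) • x)) x := by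
  rw [hasGradientAt_iff_hasFDerivAt]
  have h1 := (hY (‖x‖ ^ m)).comp_hasFDerivAt x (hasFDerivAt_norm_rpow x hm)
  refine h1.congr_fderiv ?_
  ext1 h
  simp only [smul_apply, innerSL_apply_apply, InnerProductSpace.toDual_apply_apply,
    real_inner_smul_left, smul_eq_mul]
  ring

theorem gradient_radial (hm : 1 < m) (hY : ∀ t, HasDerivAt Y (Y₁ t) t) :
    ∇ (fun x : Rn n => Y (‖x‖ ^ m)) = fun x => (m * Y₁ (‖x‖ ^ m)) • (‖x‖ ^ (m - 2) • x) :=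
  gradient_eq (hasGradientAt_radial hm hY)

theorem norm_gradient_radial (hm : 1 < m) (hY : ∀ t, HasDerivAt Y (Y₁ t) t)
    (hY₁ : ∀ t, 0 < Y₁ t) {x : Rn n} (hx : x ≠ 0) :
    ‖∇ (fun x : Rn n => Y (‖x‖ ^ m)) x‖ = m * ‖x‖ ^ (m - 1) * Y₁ (‖x‖ ^ m) := by
  have hxn : 0 < ‖x‖ := norm_pos_iff.2 hx
  have := hY₁ (‖x‖ ^ m)
  rw [gradient_radial hm hY, norm_smul, norm_smul, Real.norm_of_nonneg (by positivity),
    Real.norm_of_nonneg (by positivity), ← Real.rpow_add_one hxn.ne',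
    show m - 2 + 1 = m - 1 by ring]
  ring

theorem hasFDerivAt_gradient_radial (hm : 1 < m) (hY : ∀ t, HasDerivAt Y (Y₁ t) t)
    (hY₁ : ∀ t, HasDerivAt Y₁ (Y₂ t) t) (hpos : ∀ t, 0 < Y₁ t) {x : Rn n} (hx : x ≠ 0) :
    HasFDerivAt (∇ (fun x : Rn n => Y (‖x‖ ^ m)))
      (axial (‖x‖⁻¹ • x) ((m - 1) + m * ‖x‖ ^ m * Y₂ (‖x‖ ^ m) / Y₁ (‖x‖ ^ m))
        (m * ‖x‖ ^ (m - 2) * Y₁ (‖x‖ ^ m))) x := by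
  have hxn : 0 < ‖x‖ := norm_pos_iff.2 hx
  have h0 := hpos (‖x‖ ^ m)
  rw [gradient_radial hm hY]
  have h1 := (((hY₁ (‖x‖ ^ m)).comp_hasFDerivAt x (hasFDerivAt_norm_rpow x hm)).const_mul m).smul
    (hasFDerivAt_norm_rpow_smul m hx)
  refine h1.congr_fderiv ?_
  ext1 h
  have e1 : ‖x‖ ^ m = ‖x‖ ^ (m - 2) * (‖x‖ * ‖x‖) := by
    rw [← sq, ← Real.rpow_two, ← Real.rpow_add hxn]; congr 1; ring
  simp only [add_apply, smul_apply, ContinuousLinearMap.smulRight_apply, innerSL_apply_apply,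
    axial_apply, real_inner_smul_left, smul_eq_mul, Function.comp_apply, smul_add, smul_smul]
  rw [add_assoc, ← add_smul]
  congr 2
  · ring
  · set y := Y₁ (‖x‖ ^ m)
    set y₂ := Y₂ (‖x‖ ^ m)
    rw [e1]
    field_simp
    ring

theorem contDiffAt_radial (hY : ContDiff ℝ 2 Y) {x : Rn n} (hx : x ≠ 0) :
    ContDiffAt ℝ 2 (fun x : Rn n => Y (‖x‖ ^ m)) x :=
  hY.contDiffAt.comp x ((contDiffAt_norm ℝ hx).rpow_const_of_ne (norm_ne_zero_iff.2 hx))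

/-- The Hessian and the derivative of the p-field are axial with the same axis, so their product is
axial and its eigenvalues form a spike with entries (p-1) w^(p-2) w₂ and w^(p-1)/r, where w and w₂
are the radial slope and second derivative. -/
theorem isEntireSubsolution_radial {k : ℕ} (hk : 1 ≤ k) (hkn : k ≤ n) {p α β : ℝ} (hp : 1 < p)
    {f : ℝ → ℝ} (hf : ∀ t, 0 < f t) (hm : 1 < m) (hY : ∀ t, HasDerivAt Y (Y₁ t) t)
    (hY₁ : ∀ t, HasDerivAt Y₁ (Y₂ t) t) (hY₂ : Continuous Y₂) (hpos : ∀ t, 0 < Y₁ t)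
    (hnn : ∀ t, 0 ≤ Y₂ t)
    (hineq : ∀ r, 0 < r → r ^ (n * (α + 1) / k - 1) * f (Y (r ^ m)) ^ ((n : ℝ) / k) ≤
      (p - 1) * (m * r ^ (m - 1) * Y₁ (r ^ m)) ^ (n * (p - β - 1) / k - 1) *
        (m * (m - 1) * r ^ (m - 2) * Y₁ (r ^ m) + m ^ 2 * r ^ (2 * m - 2) * Y₂ (r ^ m))) :
    IsEntireSubsolution n k p α β f (fun x : Rn n => Y (‖x‖ ^ m)) := by
  have hk1 : (1 : ℝ) ≤ k := by exact_mod_cast hk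
  have hkn' : (k : ℝ) ≤ n := by exact_mod_cast hkn
  have hC2 := contDiff_two_of_hasDerivAt hY hY₁ hY₂
  have hn : 0 < n := by omega
  have hp1 : 0 < p - 1 := by linarith
  refine ⟨(hC2.of_le (by norm_num)).comp (contDiff_norm_rpow hm),
    fun x hx => (contDiffAt_radial hC2 hx).contDiffWithinAt, ?_, fun x hx => ?_⟩
  · refine ⟨0, EuclideanSpace.single ⟨0, hn⟩ 1, ?_⟩
    have hmono : StrictMono Y := strictMono_of_hasDerivAt_pos hY hpos
    simp only [norm_zero, PiLp.norm_single, norm_one, Real.one_rpow]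
    rw [Real.zero_rpow (by linarith)]
    exact (hmono one_pos).ne'.symm
  · have hxn : 0 < ‖x‖ := norm_pos_iff.2 hx
    have hν : ‖‖x‖⁻¹ • x‖ = 1 := by simp [norm_smul, hxn.ne']
    set r := ‖x‖ with hr
    set y := Y₁ (r ^ m) with hy
    set y₂ := Y₂ (r ^ m) with hy₂
    have hy0 : 0 < y := hpos _
    have hy₂0 : 0 ≤ y₂ := hnn _
    set w := m * r ^ (m - 1) * y with hw
    have hw0 : 0 < w := by positivity
    set w₂ := m * (m - 1) * r ^ (m - 2) * y + m ^ 2 * r ^ (2 * m - 2) * y₂ with hw₂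
    have hm1 : 0 < m - 1 := by linarith
    have hw₂0 : 0 < w₂ := by positivity
    have hgn : ‖∇ (fun x : Rn n => Y (‖x‖ ^ m)) x‖ = w := norm_gradient_radial hm hY hpos hx
    have hg0 : ∇ (fun x : Rn n => Y (‖x‖ ^ m)) x ≠ 0 := norm_ne_zero_iff.1 (by rw [hgn]; exact hw0.ne')
    have hgν : ‖∇ (fun x : Rn n => Y (‖x‖ ^ m)) x‖⁻¹ • ∇ (fun x : Rn n => Y (‖x‖ ^ m)) x
        = r⁻¹ • x := by
      rw [hgn, gradient_radial hm hY]
      simp only [smul_smul, ← hr, ← hy]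
      congr 1
      rw [hw, show m - 1 = m - 2 + 1 by ring, Real.rpow_add_one hxn.ne']
      field_simp
    have hV := fderiv_pGradField p (hasFDerivAt_gradient_radial hm hY hY₁ hpos hx) hg0
    rw [hgν, hgn] at hV
    set A := (m - 1) + m * r ^ m * y₂ / y with hA
    set s := m * r ^ (m - 2) * y with hs
    have hcomp : (axial (r⁻¹ • x) (p - 1) (w ^ (p - 2))).comp (axial (r⁻¹ • x) A s)
        = axial (r⁻¹ • x) ((p - 1) * A) (w ^ (p - 2) * s) := by
      ext1 h
      exact axial_comp_axial hν _ _ _ _ h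
    have hws : w = r * s := by
      rw [hw, hs, show m - 1 = m - 2 + 1 by ring, Real.rpow_add_one hxn.ne']; ring
    have hd₂ : w ^ (p - 2) * s = w ^ (p - 1) / r := by
      rw [show p - 1 = p - 2 + 1 by ring, Real.rpow_add_one hw0.ne']
      nth_rewrite 3 [hws]
      field_simp
    have hd₁ : w ^ (p - 2) * s * ((p - 1) * A) = (p - 1) * w ^ (p - 2) * w₂ := by
      have h1 : s * A = w₂ := by
        have e1 : r ^ (2 * m - 2) = r ^ (m - 2) * r ^ m := by
          rw [← Real.rpow_add hxn]; congr 1; ring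
        rw [hs, hA, hw₂, e1]
        field_simp
      rw [← h1]; ring
    have hd₂pos : 0 < w ^ (p - 1) / r := by positivity
    have hd₁pos : 0 < (p - 1) * w ^ (p - 2) * w₂ + ((k : ℝ) - 1) * (w ^ (p - 1) / r) := by
      have : 0 ≤ ((k : ℝ) - 1) * (w ^ (p - 1) / r) := mul_nonneg (by linarith) hd₂pos.le
      positivity
    have htuple := isEigenvalueTuple_axial hν ⟨0, hn⟩ ((p - 1) * A) (w ^ (p - 2) * s)
    rw [hd₁, hd₂] at htuple
    rw [hcomp, hd₂] at hV
    refine ⟨hV.differentiableAt, fun _ => hg0, _, ?_, spike_mem_coneP hk ⟨0, hn⟩ hd₁pos hd₂pos, ?_⟩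
    · rw [hV.fderiv]
      exact htuple
    · rw [hgn, PiK_spike_rpow hk hkn _ hd₁pos hd₂pos,
        radial_inequality_iff hk hkn hxn hw0 (hf _) hd₁pos]
      refine (hineq r hxn).trans ?_
      rw [← hy, ← hy₂, ← hw, ← hw₂]
      -- The factor k^((n-k)/k) ≥ 1 and the nonnegative tangential term can be discarded.
      have h1 : (1 : ℝ) ≤ (k : ℝ) ^ (((n : ℝ) - k) / k) :=
        Real.one_le_rpow hk1 (div_nonneg (by linarith) (by linarith))
      have h2 : 0 ≤ ((k : ℝ) - 1) * (w ^ (n * (p - β - 1) / k) / r) :=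
        mul_nonneg (by linarith) (by positivity)
      have h3 : 0 ≤ (p - 1) * w ^ (n * (p - β - 1) / k - 1) * w₂ := by positivity
      nlinarith

end RadialPower

/-! ### Weak derivatives and Sobolev regularity -/

/-- The integral of a partial derivative of a compactly supported continuous function vanishes,
even if the function fails to be differentiable at the origin. -/
theorem integral_partial_eq_zero {n : ℕ} (i : Fin n) {g : Rn n → ℝ} {g' : Rn n → Rn n →L[ℝ] ℝ}
    (hg : Continuous g) (hgc : HasCompactSupport g) (hd : ∀ x, x ≠ 0 → HasFDerivAt g (g' x) x)
    (hint : Integrable (fun x => g' x (EuclideanSpace.single i 1))) :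
    ∫ x, g' x (EuclideanSpace.single i 1) = 0 := by
  obtain ⟨l, rfl⟩ : ∃ l, n = l + 1 := ⟨n - 1, by have := i.2; omega⟩
  obtain ⟨R, hR, hgR⟩ := hgc.exists_pos_le_norm
  set L : (Fin (l + 1) → ℝ) →L[ℝ] Rn (l + 1) :=
    ((EuclideanSpace.equiv (Fin (l + 1)) ℝ).symm : (Fin (l + 1) → ℝ) →L[ℝ] Rn (l + 1)) with hL
  have hLapp : ∀ y, L y = WithLp.toLp 2 y := fun y => rfl
  have hcoord : ∀ (y : Fin (l + 1) → ℝ) j, |y j| ≤ ‖L y‖ := fun y j => by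
    exact PiLp.norm_apply_le (L y) j
  have hsingle : L (Pi.single i 1) = EuclideanSpace.single i 1 := rfl
  have hL0 : ∀ y, L y = 0 → y = 0 := fun y hy => by
    funext j
    have := hcoord y j
    rw [hy, norm_zero] at this
    exact abs_nonpos_iff.1 this
  have hzero : ∀ x, R < ‖x‖ → g' x = 0 := fun x hx => by
    have hx0 : x ≠ 0 := norm_pos_iff.1 (hR.trans hx)
    have h1 : g =ᶠ[𝓝 x] fun _ => 0 := by
      filter_upwards [continuous_norm.continuousAt.eventually (lt_mem_nhds hx)] with z hz
        using hgR z (le_of_lt hz)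
    exact (hd x hx0).unique ((hasFDerivAt_const (0 : ℝ) x).congr_of_eventuallyEq h1)
  have hmp := PiLp.volume_preserving_toLp (Fin (l + 1))
  have hme : MeasurableEmbedding (WithLp.toLp 2 : (Fin (l + 1) → ℝ) → Rn (l + 1)) :=
    (MeasurableEquiv.toLp 2 (Fin (l + 1) → ℝ)).measurableEmbedding
  have hint' : Integrable (fun y => g' (L y) (L (Pi.single i 1))) :=
    (hmp.integrable_comp_emb hme).2 hint
  have hbox : ∫ y in Icc (fun _ => -R) (fun _ => R), g' (L y) (L (Pi.single i 1))
      = ∫ y, g' (L y) (L (Pi.single i 1)) := by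
    refine setIntegral_eq_integral_of_forall_compl_eq_zero fun y hy => ?_
    obtain ⟨j, hj⟩ : ∃ j, R < |y j| := by
      by_contra! hcon
      exact hy ⟨fun j => (abs_le.1 (hcon j)).1, fun j => (abs_le.1 (hcon j)).2⟩
    rw [hzero (L y) (hj.trans_le (hcoord y j))]
    rfl
  rw [← hmp.integral_comp hme]
  change ∫ y, g' (L y) (L (Pi.single i 1)) = 0
  rw [← hbox]
  -- The divergence theorem on the box [-R, R]^n, for the field whose only nonzero component is the
  -- i-th, with exceptional set {0}; g vanishes on the faces.
  have hdiv := integral_divergence_of_hasFDerivAt_off_countable' (E := ℝ)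
    (fun _ : Fin (l + 1) => -R) (fun _ => R) (fun _ => by simp only; linarith)
    (fun j y => if j = i then g (L y) else 0)
    (fun j y => if j = i then (g' (L y)).comp L else 0) {0} (countable_singleton 0)
    (fun j => by
      by_cases hj : j = i
      · simp only [hj, if_true]; exact (hg.comp L.continuous).continuousOn
      · simp only [hj, if_false]; exact continuousOn_const)
    (fun y hy j => by
      by_cases hj : j = i
      · simp only [hj, if_true]
        exact (hd (L y) fun h => hy.2 (hL0 y h)).comp y L.hasFDerivAt
      · simp only [hj, if_false]; exact hasFDerivAt_const 0 y)
    (by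
      refine (hint'.congr (Eventually.of_forall fun y => ?_)).integrableOn
      simp only
      rw [Finset.sum_eq_single i (fun j _ hj => by simp [hj]) (by simp)]
      simp)
  have hsum : ∀ y, ∑ j, (if j = i then (g' (L y)).comp L else 0 : (Fin (l + 1) → ℝ) →L[ℝ] ℝ)
      (Pi.single j 1) = g' (L y) (L (Pi.single i 1)) := fun y => by
    rw [Finset.sum_eq_single i (fun j _ hj => by simp [hj]) (by simp)]
    simp
  simp only [hsum] at hdiv
  rw [hdiv]
  refine Finset.sum_eq_zero fun j _ => ?_
  by_cases hj : j = i
  · have hface : ∀ (c : ℝ), |c| = R → ∀ y, g (L (j.insertNth c y)) = 0 := fun c hc y => by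
      refine hgR _ ?_
      have := hcoord (j.insertNth (α := fun _ => ℝ) c y) j
      rwa [Fin.insertNth_apply_same, hc] at this
    simp only [hj, if_true]
    subst hj
    simp [hface R (abs_of_pos hR), hface (-R) (by rw [abs_neg, abs_of_pos hR])]
  · simp [hj]

/-- Apply the vanishing of the integral of a partial derivative to the product of w with a test
function. -/
theorem isWeakPartial_of_hasFDerivAt {n : ℕ} (i : Fin n) {w : Rn n → ℝ}
    {w' : Rn n → Rn n →L[ℝ] ℝ} (hw : Continuous w) (hd : ∀ x, x ≠ 0 → HasFDerivAt w (w' x) x)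
    (hint : LocallyIntegrable (fun x => w' x (EuclideanSpace.single i 1))) :
    IsWeakPartial i w (fun x => w' x (EuclideanSpace.single i 1)) := by
  refine ⟨hw.locallyIntegrable, hint, fun φ hφ hφc => ?_⟩
  have hφd : Continuous fun x => fderiv ℝ φ x (EuclideanSpace.single i 1) :=
    (hφ.continuous_fderiv (by simp)).clm_apply continuous_const
  have h1 : Integrable (fun x => w x * fderiv ℝ φ x (EuclideanSpace.single i 1)) :=
    (hw.mul hφd).integrable_of_hasCompactSupport (hφc.fderiv_apply ℝ _).mul_left
  have h2 : Integrable (fun x => w' x (EuclideanSpace.single i 1) * φ x) := by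
    simpa [mul_comm] using
      hint.integrable_smul_left_of_hasCompactSupport hφ.continuous hφc
  have h3 := integral_partial_eq_zero i (g := fun x => w x * φ x)
    (g' := fun x => w x • fderiv ℝ φ x + φ x • w' x) (hw.mul hφ.continuous) hφc.mul_left
    (fun x hx => (hd x hx).mul (hφ.differentiable (by simp) x).hasFDerivAt)
    ((h1.add h2).congr (Eventually.of_forall fun x => by simp [mul_comm]))
  have h4 : ∫ x, (w x * fderiv ℝ φ x (EuclideanSpace.single i 1)
      + w' x (EuclideanSpace.single i 1) * φ x) = 0 := by
    rw [← h3]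
    congr 1
    ext x
    simp [mul_comm]
  rw [integral_add h1 h2] at h4
  linarith

theorem LpLoc.of_continuous {n : ℕ} {δ : ℝ} {h : Rn n → ℝ} (hc : Continuous h) : LpLoc δ h := by
  intro K hK
  have : IsFiniteMeasure (volume.restrict K) := ⟨by simpa using hK.measure_lt_top⟩
  obtain ⟨C, hC⟩ := hK.exists_bound_of_continuousOn hc.continuousOn
  exact MemLp.of_bound hc.aestronglyMeasurable C
    (ae_restrict_of_forall_mem hK.measurableSet hC)

theorem LpLoc.locallyIntegrable {n : ℕ} {h : Rn n → ℝ} (hh : LpLoc 1 h) : LocallyIntegrable h :=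
  locallyIntegrable_iff.2 fun K hK => by
    have := hh K hK
    rwa [ENNReal.ofReal_one, memLp_one_iff_integrable] at this

/-- A function that is locally `O(|x| ^ (-σ))` is in `L^δ_loc` if `δ σ < n`. -/
theorem LpLoc.of_bound {n : ℕ} [Nontrivial (Rn n)] {δ σ : ℝ} (hδ : 0 < δ) (hσ : δ * σ < n)
    {h : Rn n → ℝ} (hm : Measurable h)
    (hb : ∀ R, ∃ C, ∀ x, x ≠ 0 → ‖x‖ ≤ R → |h x| ≤ C * ‖x‖ ^ (-σ)) : LpLoc δ h := by
  intro K hK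
  obtain ⟨R, hKR⟩ := hK.isBounded.subset_ball 0
  obtain ⟨C, hC⟩ := hb R
  have hn : (1 : ℝ) ≤ n := by
    have : 0 < Module.finrank ℝ (Rn n) := Module.finrank_pos
    rw [finrank_euclideanSpace_fin] at this
    exact_mod_cast this
  have hmeas : Measurable fun x : Rn n => ‖x‖ ^ (-σ) := by fun_prop
  have hpow : MemLp (fun x : Rn n => ‖x‖ ^ (-σ)) (ENNReal.ofReal δ)
      (volume.restrict (Metric.ball 0 R)) := by
    rw [← integrable_norm_rpow_iff hmeas.aestronglyMeasurable (by simpa using hδ) (by simp),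
      ENNReal.toReal_ofReal hδ.le]
    have h1 : (fun x : Rn n => ‖‖x‖ ^ (-σ)‖ ^ δ) = fun x => ‖x‖ ^ (-(δ * σ)) := by
      ext x
      rw [Real.norm_of_nonneg (by positivity), ← Real.rpow_mul (norm_nonneg x)]
      congr 1; ring
    rw [h1]
    refine (integrableOn_fun_norm_addHaar (volume : Measure (Rn n))
      (f := fun y : ℝ => y ^ (-(δ * σ)))).2 ?_
    rcases le_or_gt R 0 with hR | hR
    · simp [Ioo_eq_empty (not_lt.2 hR)]
    have h2 : IntegrableOn (fun y : ℝ => y ^ ((n : ℝ) - 1 - δ * σ)) (Ioo 0 R) :=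
      ((intervalIntegrable_iff_integrableOn_Ioo_of_le hR.le).1
        (intervalIntegral.intervalIntegrable_rpow' (by linarith)))
    refine h2.congr_fun (fun y hy => ?_) measurableSet_Ioo
    have hn1 : 1 ≤ n := by exact_mod_cast hn
    simp only [finrank_euclideanSpace_fin, smul_eq_mul]
    rw [← Real.rpow_natCast, ← Real.rpow_add hy.1, Nat.cast_sub hn1]
    congr 1; push_cast; ring
  refine ((hpow.mono_measure (Measure.restrict_mono hKR le_rfl)).const_mul C).mono'
    hm.aestronglyMeasurable ?_
  have hne : ∀ᵐ x ∂(volume.restrict K), x ≠ (0 : Rn n) :=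
    ae_restrict_of_ae (compl_mem_ae_iff.2 (measure_singleton 0))
  filter_upwards [hne, ae_restrict_mem hK.measurableSet] with x hx hxK
  exact hC x hx (mem_ball_zero_iff.1 (hKR hxK)).le

/-- The gradient is continuous and D²u = O(|x|^(m-2)) near the origin, which lies in L^δ_loc since
δ(2-m) < 1 ≤ n. -/
theorem sobolevW2Loc_radial {n : ℕ} [Nontrivial (Rn n)] {m δ : ℝ} {Y Y₁ Y₂ : ℝ → ℝ} (hm : 1 < m)
    (hY : ∀ t, HasDerivAt Y (Y₁ t) t) (hY₁ : ∀ t, HasDerivAt Y₁ (Y₂ t) t) (hY₂ : Continuous Y₂)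
    (hpos : ∀ t, 0 < Y₁ t) (hnn : ∀ t, 0 ≤ Y₂ t) (hδ : 0 < δ) (hδm : δ * (2 - m) < 1) :
    SobolevW2Loc δ (fun x : Rn n => Y (‖x‖ ^ m)) := by
  have hn : (1 : ℝ) ≤ n := by
    have : 0 < Module.finrank ℝ (Rn n) := Module.finrank_pos
    rw [finrank_euclideanSpace_fin] at this
    exact_mod_cast this
  set u : Rn n → ℝ := fun x => Y (‖x‖ ^ m) with hu_def
  have hC2 := contDiff_two_of_hasDerivAt hY hY₁ hY₂
  have hu : ContDiff ℝ 1 u := (hC2.of_le (by norm_num)).comp (contDiff_norm_rpow hm)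
  have hfd : Continuous (fderiv ℝ u) := hu.continuous_fderiv one_ne_zero
  have hgi : ∀ i, Continuous fun x => fderiv ℝ u x (EuclideanSpace.single i 1) := fun i =>
    hfd.clm_apply continuous_const
  set H : Fin n → Rn n → Rn n →L[ℝ] ℝ := fun i x =>
    (innerSL ℝ (EuclideanSpace.single i 1)).comp (fderiv ℝ (∇ u) x) with hH
  have hY₁c : Continuous Y₁ := continuous_iff_continuousAt.2 fun t => (hY₁ t).continuousAt
  have hHd : ∀ i x, x ≠ 0 →
      HasFDerivAt (fun x => fderiv ℝ u x (EuclideanSpace.single i 1)) (H i x) x := by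
    intro i x hx
    have h1 := (innerSL ℝ (EuclideanSpace.single i (1 : ℝ))).hasFDerivAt.comp x
      (hasFDerivAt_gradient (contDiffAt_radial (m := m) hC2 hx))
    refine h1.congr_of_eventuallyEq (Eventually.of_forall fun y => ?_)
    simp only [Function.comp_apply, innerSL_apply_apply]
    rw [real_inner_comm, inner_gradient_left]
  have hHm : ∀ i j, Measurable fun x => H i x (EuclideanSpace.single j 1) := fun i j =>
    (innerSL ℝ (EuclideanSpace.single i (1 : ℝ))).continuous.measurable.comp
      (measurable_fderiv_apply_const ℝ (∇ u) _)
  have hHb : ∀ i j, ∀ R, ∃ C, ∀ x, x ≠ 0 → ‖x‖ ≤ R →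
      |H i x (EuclideanSpace.single j 1)| ≤ C * ‖x‖ ^ (-(2 - m)) := by
    intro i j R
    obtain ⟨C, hC⟩ := (isCompact_closedBall (0 : Rn n) R).exists_bound_of_continuousOn
      (f := fun x => m * (Y₁ (‖x‖ ^ m) * (1 + |m - 2|) + m * ‖x‖ ^ m * Y₂ (‖x‖ ^ m)))
      (Continuous.continuousOn (by
        have : Continuous fun x : Rn n => ‖x‖ ^ m := (contDiff_norm_rpow hm).continuous
        fun_prop))
    refine ⟨C, fun x hx hxR => ?_⟩
    have hxn : 0 < ‖x‖ := norm_pos_iff.2 hx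
    have hν : ‖‖x‖⁻¹ • x‖ = 1 := by simp [norm_smul, hxn.ne']
    have h1 := hC x (by simpa using hxR)
    have hy := hpos (‖x‖ ^ m)
    have hy₂ := hnn (‖x‖ ^ m)
    have h2 : |H i x (EuclideanSpace.single j 1)| ≤ ‖fderiv ℝ (∇ u) x‖ := by
      simp only [hH, ContinuousLinearMap.comp_apply, innerSL_apply_apply]
      refine (abs_real_inner_le_norm _ _).trans ?_
      have := (fderiv ℝ (∇ u) x).le_opNorm (EuclideanSpace.single j 1)
      simpa using this
    rw [(hasFDerivAt_gradient_radial hm hY hY₁ hpos hx).fderiv] at h2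
    refine h2.trans ((norm_axial_le hν _ _).trans ?_)
    rw [abs_of_pos (by positivity), show -(2 - m) = m - 2 by ring]
    have h3 : |m - 1 + m * ‖x‖ ^ m * Y₂ (‖x‖ ^ m) / Y₁ (‖x‖ ^ m) - 1| ≤
        |m - 2| + m * ‖x‖ ^ m * Y₂ (‖x‖ ^ m) / Y₁ (‖x‖ ^ m) := by
      rw [show m - 1 + m * ‖x‖ ^ m * Y₂ (‖x‖ ^ m) / Y₁ (‖x‖ ^ m) - 1
        = (m - 2) + m * ‖x‖ ^ m * Y₂ (‖x‖ ^ m) / Y₁ (‖x‖ ^ m) by ring]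
      refine (abs_add_le _ _).trans_eq ?_
      rw [abs_of_nonneg (a := m * ‖x‖ ^ m * Y₂ (‖x‖ ^ m) / Y₁ (‖x‖ ^ m)) (by positivity)]
    calc m * ‖x‖ ^ (m - 2) * Y₁ (‖x‖ ^ m) *
          (1 + |m - 1 + m * ‖x‖ ^ m * Y₂ (‖x‖ ^ m) / Y₁ (‖x‖ ^ m) - 1|)
        ≤ m * ‖x‖ ^ (m - 2) * Y₁ (‖x‖ ^ m) *
          (1 + (|m - 2| + m * ‖x‖ ^ m * Y₂ (‖x‖ ^ m) / Y₁ (‖x‖ ^ m))) := by gcongr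
      _ = m * (Y₁ (‖x‖ ^ m) * (1 + |m - 2|) + m * ‖x‖ ^ m * Y₂ (‖x‖ ^ m)) * ‖x‖ ^ (m - 2) := by
          field_simp
          ring
      _ ≤ C * ‖x‖ ^ (m - 2) := by gcongr; exact (le_abs_self _).trans h1
  have hHloc : ∀ i j, LocallyIntegrable fun x => H i x (EuclideanSpace.single j 1) := fun i j =>
    (LpLoc.of_bound one_pos (by linarith) (hHm i j) (hHb i j)).locallyIntegrable
  refine ⟨LpLoc.of_continuous hu.continuous,
    fun i x => fderiv ℝ u x (EuclideanSpace.single i 1),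
    fun i j x => H i x (EuclideanSpace.single j 1), fun i => ⟨LpLoc.of_continuous (hgi i), ?_⟩,
    fun i j => ⟨LpLoc.of_bound hδ (by linarith) (hHm i j) (hHb i j), ?_⟩⟩
  · exact isWeakPartial_of_hasFDerivAt i hu.continuous
      (fun x _ => (hu.differentiable one_ne_zero x).hasFDerivAt) (hgi i).locallyIntegrable
  · exact isWeakPartial_of_hasFDerivAt j (hgi i) (hHd i) (hHloc i j)

end PiHessian

/-! ### The theorem -/

theorem theorem5p2 (n k : ℕ) (hk : 1 ≤ k) (hkn : k ≤ n) (p α β : ℝ) (f : ℝ → ℝ)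
    (hf_pos : ∀ t, 0 < f t) (hf_mono : Monotone f) (hf_cont : Continuous f)
    (hα : -1 < α) (hα' : α < (k : ℝ) / n - 1) (hβ : β < p - 1) (hp : 1 < p) :
    (∀ ε κ : ℝ, 0 < ε → ε < n * (α + 1) / k → κ = (1 - ε) / (n * (α + 1) / k - ε) →
      PiHessian.KellerOsserman (fun s => f s ^ (κ * n / k)) (κ * n * (p - β - 1) / k) →
      ∃ u : PiHessian.Rn n → ℝ,
        PiHessian.IsEntireSubsolution n k p α β f u ∧
        (p ≤ α + β + 2 → ContDiff ℝ 2 u) ∧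
        (α + β + 2 < p → 0 ≤ (p - 1) * α + β →
          ∀ δ : ℝ, 1 < δ → δ < (p - β - 1) / (p - α - β - 2) →
            PiHessian.SobolevW2Loc δ u)) ∧
    (∀ u : PiHessian.Rn n → ℝ,
      PiHessian.IsEntireSubsolution n k p α β f u →
      ((p ≤ α + β + 2 ∧ ContDiff ℝ 2 u) ∨
        (α + β + 2 < p ∧ 0 ≤ (p - 1) * α + β ∧
          ∃ δ : ℝ, 1 < δ ∧ δ < (p - β - 1) / (p - α - β - 2) ∧
            PiHessian.SobolevW2Loc δ u)) →
      PiHessian.KellerOsserman (fun s => f s ^ ((n : ℝ) / k)) (n * (p - β - 1) / k)) := by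
  refine ⟨fun ε κ hε hεa hκ hKO => ?_, fun u hu _ =>
    hu.kellerOsserman hk hkn hα hα' hp hβ hf_pos hf_mono hf_cont⟩
  have hk' : (0 : ℝ) < k := by exact_mod_cast hk
  have hn' : (0 : ℝ) < n := by exact_mod_cast (hk.trans hkn)
  have hnt : Nontrivial (PiHessian.Rn n) := by
    have : Nonempty (Fin n) := ⟨⟨0, hk.trans hkn⟩⟩
    infer_instance
  set F : ℝ → ℝ := fun s => f s ^ ((n : ℝ) / k) with hF
  have hFc : Continuous F := hf_cont.rpow_const fun s => Or.inl (hf_pos s).ne'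
  have hFpos : ∀ s, 0 < F s := fun s => Real.rpow_pos_of_pos (hf_pos s) _
  have hFm : Monotone F := fun s t hst =>
    Real.rpow_le_rpow (hf_pos s).le (hf_mono hst) (by positivity)
  set q := n * (p - β - 1) / k with hq_def
  have hpβ : 0 < p - β - 1 := by linarith
  have hq : 0 < q := div_pos (mul_pos hn' hpβ) hk'
  set a := n * (α + 1) / k with ha_def
  have ha : 0 < a := div_pos (mul_pos hn' (by linarith)) hk'
  have ha1 : a < 1 := by
    rw [ha_def, div_lt_one hk']
    have : α + 1 < k / n := by linarith
    rw [lt_div_iff₀ hn'] at this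
    linarith
  -- Because a < 1, the numerator 1 - ε exceeds the denominator a - ε > 0.
  have hκ1 : 1 < κ := by
    rw [hκ, one_lt_div (by linarith)]
    linarith
  have hKO' : PiHessian.KellerOsserman F q := by
    refine PiHessian.KellerOsserman.of_rpow hFc hFpos hκ1 hq ?_
    have h1 : (fun s => F s ^ κ) = fun s => f s ^ (κ * n / k) := by
      ext s
      rw [hF, ← Real.rpow_mul (hf_pos s).le]
      congr 1; ring
    rw [h1, show κ * q = κ * n * (p - β - 1) / k by rw [hq_def]; ring]
    exact hKO
  set m := 1 + a / q with hm_def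
  have haq : a / q = (α + 1) / (p - β - 1) := by rw [ha_def, hq_def]; field_simp
  have hm : 1 < m := by rw [hm_def]; linarith [div_pos ha hq]
  obtain ⟨Y, Y₁, Y₂, hY, hY₁, hY₂, hpos, hnn, hineq⟩ :=
    PiHessian.exists_radial_profile hFc hFpos hFm hp hq ha hm_def hKO'
  refine ⟨fun x => Y (‖x‖ ^ m), PiHessian.isEntireSubsolution_radial hk hkn hp hf_pos hm hY hY₁
    hY₂ hpos hnn hineq, fun hle => ?_, fun hlt _ δ hδ hδ' => ?_⟩
  -- m - 1 = (α+1)/(p-β-1), so m ≥ 2 is exactly p ≤ α+β+2.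
  · have hm2 : 2 ≤ m := by
      have : 1 ≤ a / q := by rw [haq, one_le_div hpβ]; linarith
      linarith
    exact (PiHessian.contDiff_two_of_hasDerivAt hY hY₁ hY₂).comp
      (PiHessian.contDiff_two_norm_rpow hm2)
  · refine PiHessian.sobolevW2Loc_radial hm hY hY₁ hY₂ hpos hnn (by linarith) ?_
    have h1 : 2 - m = (p - α - β - 2) / (p - β - 1) := by
      rw [hm_def, haq]; field_simp; ring
    rw [lt_div_iff₀ (by linarith)] at hδ'
    rw [h1, ← mul_div_assoc, div_lt_one hpβ]
    exact hδ'
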